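/- Let $\Bbbk$ be a field of characteristic $0$ and let $\mathcal G$ be a (discrete) groupoid with object set $\mathcal G^{(0)}$, source $s$, target $t$ and units $i(x)$, the product $gh$ being defined when $s(g)=t(h)$. Put $A=\mathrm{Fun}(\mathcal G^{(0)},\Bbbk)$. *Representations.* An $n$-dimensional $\mathcal G$-representation $\mathcal E$ consists of $\Bbbk$-vector spaces $E_x$ with isomorphisms $\Bbbk^n\cong E_x$ ($x\in\mathcal G^{(0)}$) and linear isomorphisms $\rho^{\mathcal E}_g:E_{s(g)}\to E_{t(g)}$ ($g\in\mathcal G$) with $\rho^{\mathcal E}_{i(x)}=\mathrm{id}$ and $\rho^{\mathcal E}_{gh}=\rho^{\mathcal E}_g\rho^{\mathcal E}_h$. A morphism $\lambda:\mathcal E\to\mathcal F$ is a family of linear maps $\lambda_x:E_x\to F_x$ with $\rho^{\mathcal F}_g\lambda_{s(g)}=\lambda_{t(g)}\rho^{\mathcal E}_g$, and $T_{\mathcal E}$ is the ring of endomorphisms of $\mathcal E$. Write $\Gamma(\mathcal E)=\prod_xE_x$, $\Gamma(\mathcal E^*)=\prod_xE_x^*$, and let $\mathcal I$ be the trivial representation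 with fibres $\Bbbk$. The dual representation $\mathcal E^*$ is given by $\rho^{\mathcal E^*}_g(\varphi)=\varphi\circ\rho^{\mathcal E}_{g^{-1}}$, and tensor products are taken fibrewise. *Representative functions.* $\mathcal R_\Bbbk(\mathcal G)$ is the quotient of $\bigoplus_{\mathcal E}\Gamma(\mathcal E^*)\otimes_{T_{\mathcal E}}\Gamma(\mathcal E)$ (over isomorphism classes of representations) by the ideal generated by all $\varphi\otimes\lambda p-\varphi\lambda\otimes p$, where $\lambda:\mathcal E\to\mathcal F$ is a morphism, $\varphi\in\Gamma(\mathcal F^*)$ and $p\in\Gamma(\mathcal E)$. The class of $\varphi\otimes p$ is written $\overline{\varphi\otimes p}$. It is a commutative $\Bbbk$-algebra with $\overline{\varphi\otimes p}\;\overline{\psi\otimes q}=\overline{(\varphi\otimes_A\psi)\otimes(p\otimes_A q)}$, and a commutative Hopf algebroid $\mathcal H$ over $A$ with $$\bar s(a)=\overline{1_A\otimes a},\qquad \bar t(a)=\overline{a\otimes 1_A}\quad(\text{in the summand of }\mathcal I),\qquad \Delta(\overline{\varphi\otimes p})=\sum_i\overline{\varphi\otimes e_i}\otimes_A\overline{e_i^*\otimes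 p},$$ $$\varepsilon(\overline{\varphi\otimes p})(x)=\varphi(x)(p(x)),\qquad S(\overline{\varphi\otimes p})=\overline{\tilde p\otimes\varphi},$$ where $\{e_i,e_i^*\}$ is a dual basis of the $A$-module $\Gamma(\mathcal E)$ and $\tilde p\in\Gamma(\mathcal E^{**})$ is evaluation at $p$. There is an algebra map $\zeta:\mathcal R_\Bbbk(\mathcal G)\to\mathrm{Fun}(\mathcal G,\Bbbk)$, $\zeta(\overline{\varphi\otimes p})(g)=\varphi(t(g))\big(\rho^{\mathcal E}_g(p(s(g)))\big)$. *Regular monoids.* A regular monoid is a monoid with a chosen operation $m\mapsto m^*$ such that $mm^*m=m$ and $m^*mm^*=m^*$; a morphism of regular monoids is a map preserving products, units and $(\ )^*$. *Local bisections.* A local bisection of $\mathcal G$ is a pair $(u,X)$ with $X\subseteq\mathcal G^{(0)}$ and $u:X\to\mathcal G$ such that $s\circ u=\mathrm{id}_X$ and $t\circ u$ is injective. The set $\mathfrak B(\mathcal G)$ of local bisections is a regular monoid with product $(u,X)(v,Y)=(uv,Z)$, $Z=\{y\in Y: t(v(y))\in X\}$, $(uv)(y)=u(t(v(y)))\,v(y)$,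 unit $(i,\mathcal G^{(0)})$ and pseudo-inverse $(u,X)^*=(\bar u,t(u(X)))$, $\bar u(t(u(x)))=u(x)^{-1}$. *Local biretractions.* A local biretraction of a commutative Hopf algebroid $\mathcal H$ over $A$ with source $\bar s$ and target $\bar t$ is a linear multiplicative map $\alpha:\mathcal H\to A$ such that (BRT1) $\alpha(\bar s(a))=a\,\alpha(1)$ for all $a\in A$, and (BRT2) there is $e^\alpha\in A$ with $\alpha(\bar t(e^\alpha))=\alpha(1)$ for which $\alpha\circ\bar t$ restricts to a bijection $Ae^\alpha\to A\alpha(1)$. The set $\mathfrak{Brt}(\mathcal H,A)$ of local biretractions is a regular monoid with product $(\alpha*\beta)(h)=\beta\big(\bar t(\alpha(h_{(1)}))\big)\,\beta(h_{(2)})$, unit $\varepsilon$ and pseudo-inverse $\alpha^*=(\alpha\circ \bar t|_{Ae^\alpha})^{-1}\circ\alpha\circ S$. **Proposition.** For every local bisection $(u,X)$ of $\mathcal G$ there is exactly one linear map $\alpha_{(u,X)}:\mathcal R_\Bbbk(\mathcal G)\to A$ with $$\alpha_{(u,X)}(\overline{\varphi\otimes p})(x)=\begin{cases}\varphi(t(u(x)))\big(\rho^{\mathcal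 E}_{u(x)}(p(x))\big)&x\in X,\\0&x\notin X,\end{cases}$$ for all representations $\mathcal E$, $\varphi\in\Gamma(\mathcal E^*)$, $p\in\Gamma(\mathcal E)$ and $x\in\mathcal G^{(0)}$. It satisfies $\alpha_{(u,X)}(F)(x)=\zeta(F)(u(x))$ for $x\in X$ and $\alpha_{(u,X)}(F)(x)=0$ for $x\notin X$, for all $F\in\mathcal R_\Bbbk(\mathcal G)$. Each $\alpha_{(u,X)}$ is a local biretraction of $\mathcal H=\mathcal R_\Bbbk(\mathcal G)$, and $(u,X)\mapsto\alpha_{(u,X)}$ is a morphism of regular monoids $\mathfrak B(\mathcal G)\to\mathfrak{Brt}(\mathcal H,A)$: it preserves products, the unit and pseudo-inverses. -/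

import Mathlib

open scoped TensorProduct

/-! ### Regular monoids -/

class RegularMonoid (M : Type*) extends Monoid M where
  pinv : M → M
  mul_pinv_mul : ∀ m : M, m * pinv m * m = m
  pinv_mul_pinv : ∀ m : M, pinv m * m * pinv m = pinv m

structure RegularMonoidHom (M N : Type*) [RegularMonoid M] [RegularMonoid N] extends M →* N where
  map_pinv : ∀ m : M, toFun (RegularMonoid.pinv m) = RegularMonoid.pinv (toFun m)

/-! ### Tensor products over `A` along two algebra maps -/

section TensorOver

variable {k A H H' C : Type*} [CommRing k] [CommRing A] [Algebra k A]
  [CommRing H] [Algebra k H] [CommRing H'] [Algebra k H'] [CommRing C] [Algebra k C]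

/-- The algebra `H`, regarded as an `A`-algebra through `f : A → H`. -/
def Via (_f : A →ₐ[k] H) : Type _ := H

instance (f : A →ₐ[k] H) : CommRing (Via f) := inferInstanceAs (CommRing H)
instance (f : A →ₐ[k] H) : Algebra k (Via f) := inferInstanceAs (Algebra k H)
instance (f : A →ₐ[k] H) : Algebra A (Via f) := f.toRingHom.toAlgebra
instance (f : A →ₐ[k] H) : IsScalarTower k A (Via f) :=
  IsScalarTower.of_algebraMap_eq fun r => (f.commutes r).symm

/-- `H ⊗_A H'`, where `A` acts on `H` through `f` and on `H'` through `g`. -/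
def TensorOver (f : A →ₐ[k] H) (g : A →ₐ[k] H') : Type _ := Via f ⊗[A] Via g

namespace TensorOver

variable (f : A →ₐ[k] H) (g : A →ₐ[k] H')

noncomputable instance : CommRing (TensorOver f g) :=
  inferInstanceAs (CommRing (Via f ⊗[A] Via g))
noncomputable instance : Algebra k (TensorOver f g) :=
  inferInstanceAs (Algebra k (Via f ⊗[A] Via g))

/-- The pure tensor `h ⊗ h'`. -/
noncomputable def tmul (h : H) (h' : H') : TensorOver f g :=
  TensorProduct.tmul A (M := Via f) (N := Via g) h h'

variable {f g}

theorem tmul_mul_tmul (h₁ h₂ : H) (h₁' h₂' : H') :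
    tmul f g h₁ h₁' * tmul f g h₂ h₂' = tmul f g (h₁ * h₂) (h₁' * h₂') :=
  Algebra.TensorProduct.tmul_mul_tmul (A := Via f) (B := Via g) _ _ _ _

theorem one_eq : (1 : TensorOver f g) = tmul f g 1 1 := rfl

theorem add_tmul (h₁ h₂ : H) (h' : H') :
    tmul f g (h₁ + h₂) h' = tmul f g h₁ h' + tmul f g h₂ h' :=
  TensorProduct.add_tmul (M := Via f) (N := Via g) _ _ _

theorem tmul_add (h : H) (h₁ h₂ : H') :
    tmul f g h (h₁ + h₂) = tmul f g h h₁ + tmul f g h h₂ :=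
  TensorProduct.tmul_add (M := Via f) (N := Via g) _ _ _

theorem smul_tmul_left (c : k) (h : H) (h' : H') :
    tmul f g (c • h) h' = c • tmul f g h h' :=
  (TensorProduct.smul_tmul' (M := Via f) (N := Via g) _ _ _).symm

theorem tmul_balanced (a : A) (h : H) (h' : H') :
    tmul f g (h * f a) h' = tmul f g h (g a * h') := by
  have := TensorProduct.smul_tmul (R := A) (R' := A) (M := Via f) (N := Via g) a h h'
  rw [mul_comm]
  exact this

theorem tmul_smul_right (c : k) (h : H) (h' : H') :
    tmul f g h (c • h') = c • tmul f g h h' := by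
  rw [← smul_tmul_left]
  have := tmul_balanced (f := f) (g := g) (algebraMap k A c) h h'
  rw [AlgHom.commutes, AlgHom.commutes] at this
  rw [Algebra.smul_def, Algebra.smul_def, mul_comm _ h, this]

theorem induction {P : TensorOver f g → Prop} (z : TensorOver f g) (h0 : P 0)
    (ht : ∀ h h', P (tmul f g h h')) (ha : ∀ x y, P x → P y → P (x + y)) : P z :=
  TensorProduct.induction_on (R := A) (M := Via f) (N := Via g) (motive := P) z h0 ht ha

/-- Additive maps out of `H ⊗_A H'` from `A`-balanced biadditive maps. -/
noncomputable def liftAdd {M : Type*} [AddCommMonoid M] (F : H →+ H' →+ M)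
    (hF : ∀ (a : A) h h', F (h * f a) h' = F h (g a * h')) : TensorOver f g →+ M :=
  TensorProduct.liftAddHom (R := A) (M := Via f) (N := Via g) F
    (fun a (h : H) (h' : H') => by
      have := hF a h h'
      rw [mul_comm] at this
      exact this)

@[simp] theorem liftAdd_tmul {M : Type*} [AddCommMonoid M] (F : H →+ H' →+ M)
    (hF : ∀ (a : A) h h', F (h * f a) h' = F h (g a * h')) (h : H) (h' : H') :
    liftAdd F hF (tmul f g h h') = F h h' :=
  TensorProduct.liftAddHom_tmul (R := A) (M := Via f) (N := Via g) F _ h h'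

variable (f g)

noncomputable def inl : H →ₐ[k] TensorOver f g where
  toFun h := tmul f g h 1
  map_one' := rfl
  map_mul' x y := by rw [tmul_mul_tmul, one_mul]
  map_zero' := TensorProduct.zero_tmul (M := Via f) (N := Via g) _
  map_add' x y := add_tmul _ _ _
  commutes' r := by rw [Algebra.algebraMap_eq_smul_one, smul_tmul_left,
    Algebra.algebraMap_eq_smul_one]; rfl

noncomputable def inr : H' →ₐ[k] TensorOver f g where
  toFun h := tmul f g 1 h
  map_one' := rfl
  map_mul' x y := by rw [tmul_mul_tmul, one_mul]
  map_zero' := TensorProduct.tmul_zero (M := Via f) (N := Via g) _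
  map_add' x y := tmul_add _ _ _
  commutes' r := by rw [Algebra.algebraMap_eq_smul_one, tmul_smul_right,
    Algebra.algebraMap_eq_smul_one]; rfl

variable {f g}

theorem inl_apply (h : H) : inl f g h = tmul f g h 1 := rfl
theorem inr_apply (h : H') : inr f g h = tmul f g 1 h := rfl

theorem tmul_eq (h : H) (h' : H') : tmul f g h h' = inl f g h * inr f g h' := by
  rw [inl_apply, inr_apply, tmul_mul_tmul, one_mul, mul_one]

theorem inl_eq_inr (a : A) : inl f g (f a) = inr f g (g a) := by
  have := tmul_balanced (f := f) (g := g) a 1 1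
  rwa [one_mul, mul_one] at this

/-- The additive map `h ⊗ h' ↦ F h * G h'` underlying `lift`. -/
noncomputable def liftAux (F : H →ₐ[k] C) (G : H' →ₐ[k] C) (hFG : ∀ a, F (f a) = G (g a)) :
    TensorOver f g →+ C :=
  liftAdd
    ((AddMonoidHom.mul (R := C)).compl₂ G.toRingHom.toAddMonoidHom |>.comp
      F.toRingHom.toAddMonoidHom)
    (fun a h h' => by
      change F (h * f a) * G h' = F h * G (g a * h')
      rw [map_mul, map_mul, hFG, mul_assoc])

theorem liftAux_tmul (F : H →ₐ[k] C) (G : H' →ₐ[k] C) (hFG : ∀ a, F (f a) = G (g a))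
    (h : H) (h' : H') : liftAux F G hFG (tmul f g h h') = F h * G h' :=
  liftAdd_tmul (f := f) (g := g) _ _ h h'

/-- Algebra maps out of `H ⊗_A H'`: `h ⊗ h' ↦ F h * G h'`. -/
noncomputable def lift (F : H →ₐ[k] C) (G : H' →ₐ[k] C) (hFG : ∀ a, F (f a) = G (g a)) :
    TensorOver f g →ₐ[k] C where
  toFun := liftAux F G hFG
  map_one' := by rw [one_eq, liftAux_tmul, map_one, map_one, one_mul]
  map_mul' x y := by
    refine induction (P := fun x => liftAux F G hFG (x * y) =
      liftAux F G hFG x * liftAux F G hFG y) x ?_ (fun h h' => ?_) (fun x₁ x₂ h₁ h₂ => ?_)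
    · rw [zero_mul, map_zero, zero_mul]
    · refine induction (P := fun y => liftAux F G hFG (tmul f g h h' * y) =
        liftAux F G hFG (tmul f g h h') * liftAux F G hFG y) y ?_
        (fun l l' => ?_) (fun x₁ x₂ h₁ h₂ => ?_)
      · rw [mul_zero, map_zero, mul_zero]
      · rw [tmul_mul_tmul, liftAux_tmul, liftAux_tmul, liftAux_tmul, map_mul, map_mul,
          mul_mul_mul_comm]
      · rw [mul_add, map_add, map_add, h₁, h₂, mul_add]
    · rw [add_mul, map_add, map_add, h₁, h₂, add_mul]
  map_zero' := map_zero _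
  map_add' := map_add _
  commutes' r := by
    rw [Algebra.algebraMap_eq_smul_one, one_eq, ← smul_tmul_left, liftAux_tmul, map_one, mul_one,
      map_smul, map_one, ← Algebra.algebraMap_eq_smul_one]

@[simp] theorem lift_tmul (F : H →ₐ[k] C) (G : H' →ₐ[k] C) (hFG : ∀ a, F (f a) = G (g a))
    (h : H) (h' : H') : lift F G hFG (tmul f g h h') = F h * G h' :=
  liftAux_tmul F G hFG h h'

end TensorOver

end TensorOver

/-! ### Commutative Hopf algebroids -/

open TensorOver in
/-- The data of a commutative Hopf algebroid `H` over the commutative base algebra `A`: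
source, target, comultiplication `Δ : H → H ⊗_A H` (the left factor is an `A`-module through the
source, the right one through the target), counit and antipode, with the compatibilities of these
maps with source and target. -/
structure CommHopfAlgebroidData (k A H : Type*) [CommRing k] [CommRing A] [Algebra k A]
    [CommRing H] [Algebra k H] where
  s : A →ₐ[k] H
  t : A →ₐ[k] H
  Δ : H →ₐ[k] TensorOver s t
  ε : H →ₐ[k] A
  S : H →ₐ[k] H
  Δ_s : ∀ a, Δ (s a) = tmul s t 1 (s a)
  Δ_t : ∀ a, Δ (t a) = tmul s t (t a) 1
  ε_s : ∀ a, ε (s a) = a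
  ε_t : ∀ a, ε (t a) = a
  S_s : ∀ a, S (s a) = t a
  S_t : ∀ a, S (t a) = s a

namespace CommHopfAlgebroidData

open TensorOver

variable {k A H : Type*} [CommRing k] [CommRing A] [Algebra k A] [CommRing H] [Algebra k H]
  (𝓗 : CommHopfAlgebroidData k A H)

/-- `H ⊗_A H`. -/
abbrev T2 := TensorOver 𝓗.s 𝓗.t

/-- `(H ⊗_A H) ⊗_A H`. -/
abbrev T3 := TensorOver ((inr 𝓗.s 𝓗.t).comp 𝓗.s) 𝓗.t

theorem inl_tmul_one_s (a : A) :
    (inl ((inr 𝓗.s 𝓗.t).comp 𝓗.s) 𝓗.t) (tmul 𝓗.s 𝓗.t 1 (𝓗.s a)) =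
      inr ((inr 𝓗.s 𝓗.t).comp 𝓗.s) 𝓗.t (𝓗.t a) :=
  inl_eq_inr (f := (inr 𝓗.s 𝓗.t).comp 𝓗.s) (g := 𝓗.t) a

/-- `Δ ⊗ id`. -/
noncomputable def ΔId : 𝓗.T2 →ₐ[k] 𝓗.T3 :=
  lift ((inl _ _).comp 𝓗.Δ) (inr _ _) fun a => by
    rw [AlgHom.comp_apply, 𝓗.Δ_s]
    exact 𝓗.inl_tmul_one_s a

/-- `h ⊗ l ↦ (1 ⊗ h) ⊗ l`. -/
noncomputable def oneTmul : 𝓗.T2 →ₐ[k] 𝓗.T3 :=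
  lift ((inl _ _).comp (inr _ _)) (inr _ _) fun a => by
    rw [AlgHom.comp_apply]
    exact 𝓗.inl_tmul_one_s a

theorem oneTmul_tmul (h l : H) :
    𝓗.oneTmul (tmul 𝓗.s 𝓗.t h l) = tmul _ _ (tmul 𝓗.s 𝓗.t 1 h) l := by
  rw [oneTmul, lift_tmul, AlgHom.comp_apply, inr_apply, tmul_eq (_ : 𝓗.T2) l]

theorem ΔId_tmul (h l : H) : 𝓗.ΔId (tmul 𝓗.s 𝓗.t h l) =
    tmul ((inr 𝓗.s 𝓗.t).comp 𝓗.s) 𝓗.t (𝓗.Δ h) l :=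
  (lift_tmul (f := 𝓗.s) (g := 𝓗.t) ((inl _ _).comp 𝓗.Δ) (inr _ _) _ h l).trans
    (tmul_eq (f := (inr 𝓗.s 𝓗.t).comp 𝓗.s) (g := 𝓗.t) (𝓗.Δ h) l).symm

/-- `id ⊗ Δ`, followed by the associativity isomorphism: `h ⊗ l ↦ (h ⊗ l₁) ⊗ l₂`. -/
noncomputable def idΔ : 𝓗.T2 →ₐ[k] 𝓗.T3 :=
  lift ((inl _ _).comp (inl _ _)) (𝓗.oneTmul.comp 𝓗.Δ) fun a => by
    rw [AlgHom.comp_apply, AlgHom.comp_apply, 𝓗.Δ_t, oneTmul_tmul, inl_eq_inr]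
    rfl

theorem idΔ_tmul (h l : H) : 𝓗.idΔ (tmul 𝓗.s 𝓗.t h l) =
    tmul ((inr 𝓗.s 𝓗.t).comp 𝓗.s) 𝓗.t (tmul 𝓗.s 𝓗.t h 1) 1 * 𝓗.oneTmul (𝓗.Δ l) :=
  lift_tmul (f := 𝓗.s) (g := 𝓗.t) ((inl _ _).comp (inl _ _)) (𝓗.oneTmul.comp 𝓗.Δ) _ h l

theorem tmul_mul_oneTmul (h l m : H) :
    tmul ((inr 𝓗.s 𝓗.t).comp 𝓗.s) 𝓗.t (tmul 𝓗.s 𝓗.t h 1) 1 * 𝓗.oneTmul (tmul 𝓗.s 𝓗.t l m) =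
      tmul ((inr 𝓗.s 𝓗.t).comp 𝓗.s) 𝓗.t (tmul 𝓗.s 𝓗.t h l) m := by
  rw [oneTmul_tmul]
  refine (tmul_mul_tmul (f := (inr 𝓗.s 𝓗.t).comp 𝓗.s) (g := 𝓗.t) _ _ _ _).trans ?_
  rw [tmul_mul_tmul, one_mul, mul_one, one_mul]

theorem ΔId_sum {ι : Type*} (I : Finset ι) (h l : ι → H) (z : H)
    (hz : 𝓗.Δ z = ∑ i ∈ I, tmul 𝓗.s 𝓗.t (h i) (l i)) (m : H) :
    𝓗.ΔId (tmul 𝓗.s 𝓗.t z m) =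
      ∑ i ∈ I, tmul ((inr 𝓗.s 𝓗.t).comp 𝓗.s) 𝓗.t (tmul 𝓗.s 𝓗.t (h i) (l i)) m := by
  rw [ΔId_tmul, hz]
  exact map_sum (AddMonoidHom.mk'
    (fun w : 𝓗.T2 => tmul ((inr 𝓗.s 𝓗.t).comp 𝓗.s) 𝓗.t w m) (fun a b => add_tmul a b m)) _ I

theorem idΔ_sum {ι : Type*} (I : Finset ι) (h l : ι → H) (z : H)
    (hz : 𝓗.Δ z = ∑ i ∈ I, tmul 𝓗.s 𝓗.t (h i) (l i)) (m : H) :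
    𝓗.idΔ (tmul 𝓗.s 𝓗.t m z) =
      ∑ i ∈ I, tmul ((inr 𝓗.s 𝓗.t).comp 𝓗.s) 𝓗.t (tmul 𝓗.s 𝓗.t m (h i)) (l i) := by
  rw [idΔ_tmul, hz, map_sum, Finset.mul_sum]
  exact Finset.sum_congr rfl fun i _ => 𝓗.tmul_mul_oneTmul _ _ _

/-- `h ⊗ l ↦ ε(h) ▹ l = t(ε(h)) l`. -/
noncomputable def εId : 𝓗.T2 →ₐ[k] H :=
  lift (𝓗.t.comp 𝓗.ε) (AlgHom.id k H) fun a => by simp [𝓗.ε_s]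

/-- `h ⊗ l ↦ h ◃ ε(l) = h s(ε(l))`. -/
noncomputable def idε : 𝓗.T2 →ₐ[k] H :=
  lift (AlgHom.id k H) (𝓗.s.comp 𝓗.ε) fun a => by simp [𝓗.ε_t]

/-- `h ⊗ l ↦ S(h) l`. -/
noncomputable def SId : 𝓗.T2 →ₐ[k] H :=
  lift 𝓗.S (AlgHom.id k H) fun a => by simp [𝓗.S_s]

/-- `h ⊗ l ↦ h S(l)`. -/
noncomputable def idS : 𝓗.T2 →ₐ[k] H :=
  lift (AlgHom.id k H) 𝓗.S fun a => by simp [𝓗.S_t]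

theorem εId_tmul (h l : H) : 𝓗.εId (tmul 𝓗.s 𝓗.t h l) = 𝓗.t (𝓗.ε h) * l :=
  lift_tmul (f := 𝓗.s) (g := 𝓗.t) (𝓗.t.comp 𝓗.ε) (AlgHom.id k H) _ h l

theorem idε_tmul (h l : H) : 𝓗.idε (tmul 𝓗.s 𝓗.t h l) = h * 𝓗.s (𝓗.ε l) :=
  lift_tmul (f := 𝓗.s) (g := 𝓗.t) (AlgHom.id k H) (𝓗.s.comp 𝓗.ε) _ h l

theorem SId_tmul (h l : H) : 𝓗.SId (tmul 𝓗.s 𝓗.t h l) = 𝓗.S h * l :=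
  lift_tmul (f := 𝓗.s) (g := 𝓗.t) 𝓗.S (AlgHom.id k H) _ h l

theorem idS_tmul (h l : H) : 𝓗.idS (tmul 𝓗.s 𝓗.t h l) = h * 𝓗.S l :=
  lift_tmul (f := 𝓗.s) (g := 𝓗.t) (AlgHom.id k H) 𝓗.S _ h l

end CommHopfAlgebroidData

/-- A commutative Hopf algebroid `H` over a commutative base algebra `A`. -/
structure CommHopfAlgebroid (k A H : Type*) [CommRing k] [CommRing A] [Algebra k A]
    [CommRing H] [Algebra k H] extends CommHopfAlgebroidData k A H where
  coassoc : ∀ h, toCommHopfAlgebroidData.ΔId (Δ h) = toCommHopfAlgebroidData.idΔ (Δ h)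
  counit_left : ∀ h, toCommHopfAlgebroidData.εId (Δ h) = h
  counit_right : ∀ h, toCommHopfAlgebroidData.idε (Δ h) = h
  antipode_left : ∀ h, toCommHopfAlgebroidData.SId (Δ h) = s (ε h)
  antipode_right : ∀ h, toCommHopfAlgebroidData.idS (Δ h) = t (ε h)

/-! ### Local biretractions -/

/-- A local biretraction: a linear multiplicative map `α : H → A` with
(BRT1) `α(s(a)) = a α(1)`, and (BRT2) there is `e ∈ A` with `α(t(e)) = α(1)` such that
`α ∘ t` restricts to a bijection from the ideal `Ae` onto the ideal `Aα(1)`. -/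
structure LocalBiretraction {k A H : Type*} [CommRing k] [CommRing A] [Algebra k A]
    [CommRing H] [Algebra k H] (𝓗 : CommHopfAlgebroid k A H) where
  toHom : H →ₙₐ[k] A
  map_s : ∀ a, toHom (𝓗.s a) = a * toHom 1
  exists_idem : ∃ e : A, toHom (𝓗.t e) = toHom 1 ∧
    Set.BijOn (fun a => toHom (𝓗.t a)) (Ideal.span {e}) (Ideal.span {toHom 1})

namespace LocalBiretraction

open TensorOver

variable {k A H : Type*} [CommRing k] [CommRing A] [Algebra k A]
    [CommRing H] [Algebra k H] {𝓗 : CommHopfAlgebroid k A H}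

instance : CoeFun (LocalBiretraction 𝓗) (fun _ => H → A) := ⟨fun α => α.toHom⟩

theorem ext' {α β : LocalBiretraction 𝓗} (h : ∀ x, α x = β x) : α = β := by
  obtain ⟨α, _, _⟩ := α
  obtain ⟨β, _, _⟩ := β
  have : α = β := NonUnitalAlgHom.ext h
  subst this
  rfl

/-- The idempotent `e^α`. -/
noncomputable def e (α : LocalBiretraction 𝓗) : A := α.exists_idem.choose

section lemmas
variable (α : LocalBiretraction 𝓗)

theorem map_mul (x y : H) : α (x * y) = α x * α y := _root_.map_mul α.toHom x y
theorem map_add (x y : H) : α (x + y) = α x + α y := _root_.map_add α.toHom x y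
theorem map_t_mul (x y : A) : α (𝓗.t (x * y)) = α (𝓗.t x) * α (𝓗.t y) := by
  rw [_root_.map_mul, map_mul]

theorem map_e : α (𝓗.t α.e) = α 1 := α.exists_idem.choose_spec.1

theorem bijOn : Set.BijOn (fun a => α (𝓗.t a)) (Ideal.span {α.e}) (Ideal.span {α 1}) :=
  α.exists_idem.choose_spec.2

theorem mul_map_one (x : H) : α x * α 1 = α x := by rw [← map_mul, mul_one]

theorem map_mul_s (x : H) (a : A) : α (x * 𝓗.s a) = α x * a := by
  rw [map_mul, α.map_s, mul_comm a, ← mul_assoc, mul_map_one]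

theorem e_idem : α.e * α.e = α.e := by
  refine α.bijOn.injOn (Ideal.mul_mem_left _ _ (Ideal.mem_span_singleton_self _))
    (Ideal.mem_span_singleton_self _) ?_
  rw [map_t_mul, map_e, mul_map_one]

theorem mem_e_iff (x : A) : x ∈ Ideal.span {α.e} ↔ x * α.e = x := by
  rw [Ideal.mem_span_singleton']
  constructor
  · rintro ⟨r, rfl⟩
    rw [mul_assoc, e_idem]
  · exact fun h => ⟨x, h⟩

theorem mem_one_iff (x : A) : x ∈ Ideal.span {α 1} ↔ x * α 1 = x := by
  rw [Ideal.mem_span_singleton']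
  constructor
  · rintro ⟨r, rfl⟩
    rw [mul_assoc, mul_map_one]
  · exact fun h => ⟨x, h⟩

theorem inj {x y : A} (hx : x * α.e = x) (hy : y * α.e = y) (h : α (𝓗.t x) = α (𝓗.t y)) :
    x = y :=
  α.bijOn.injOn ((α.mem_e_iff x).2 hx) ((α.mem_e_iff y).2 hy) h

/-- The inverse of the bijection `α ∘ t : Ae^α → Aα(1)`. -/
noncomputable def tInv (x : A) : A :=
  Function.invFunOn (fun a => α (𝓗.t a)) (Ideal.span {α.e}) x

theorem tInv_spec {x : A} (hx : x * α 1 = x) :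
    α.tInv x * α.e = α.tInv x ∧ α (𝓗.t (α.tInv x)) = x := by
  have := α.bijOn.surjOn ((α.mem_one_iff x).2 hx)
  exact ⟨(α.mem_e_iff _).1 (Function.invFunOn_mem this), Function.invFunOn_eq this⟩

end lemmas

/-- The additive map underlying `pairing`. -/
noncomputable def pairingAux (𝓗 : CommHopfAlgebroid k A H) {H' : Type*} [CommRing H'] [Algebra k H']
    (f : A →ₐ[k] H') (α : H' →ₙₐ[k] A) (hα : ∀ x a, α (x * f a) = α x * a) (β : H →ₙₐ[k] A) :
    TensorOver f 𝓗.t →+ A :=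
  liftAdd
    (AddMonoidHom.mk' (fun x => AddMonoidHom.mk' (fun l => β (𝓗.t (α x)) * β l)
      (fun l l' => by rw [_root_.map_add, mul_add]))
      (fun x x' => by
        ext l
        change β (𝓗.t (α (x + x'))) * β l = β (𝓗.t (α x)) * β l + β (𝓗.t (α x')) * β l
        rw [_root_.map_add, _root_.map_add, _root_.map_add, add_mul]))
    (fun a x l => by
      change β (𝓗.t (α (x * f a))) * β l = β (𝓗.t (α x)) * β (𝓗.t a * l)
      rw [hα, _root_.map_mul, _root_.map_mul, _root_.map_mul, mul_assoc])

theorem pairingAux_tmul {H' : Type*} [CommRing H'] [Algebra k H']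
    (f : A →ₐ[k] H') (α : H' →ₙₐ[k] A) (hα : ∀ x a, α (x * f a) = α x * a) (β : H →ₙₐ[k] A)
    (x : H') (l : H) :
    pairingAux 𝓗 f α hα β (tmul f 𝓗.t x l) = β (𝓗.t (α x)) * β l :=
  liftAdd_tmul (f := f) (g := 𝓗.t) _ _ x l

/-- For `α` on `H'` and `β` on `H`, the map `h ⊗ l ↦ β(t(α(h))) β(l)`. -/
noncomputable def pairing (𝓗 : CommHopfAlgebroid k A H) {H' : Type*} [CommRing H'] [Algebra k H']
    (f : A →ₐ[k] H') (α : H' →ₙₐ[k] A) (hα : ∀ x a, α (x * f a) = α x * a) (β : H →ₙₐ[k] A) :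
    TensorOver f 𝓗.t →ₙₐ[k] A :=
  let L := pairingAux 𝓗 f α hα β
  have hL : ∀ x l, L (tmul f 𝓗.t x l) = β (𝓗.t (α x)) * β l := pairingAux_tmul f α hα β
  { toFun := L
    map_smul' := fun c z => by
      refine induction (P := fun z => L (c • z) = c • L z) z ?_ (fun x l => ?_)
        (fun z z' h h' => ?_)
      · rw [smul_zero, map_zero, smul_zero]
      · rw [← smul_tmul_left, hL, hL, map_smul, map_smul, map_smul, smul_mul_assoc]
      · rw [smul_add, _root_.map_add, h, h', _root_.map_add, smul_add]
    map_zero' := map_zero L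
    map_add' := _root_.map_add L
    map_mul' := fun z w => by
      refine induction (P := fun z => L (z * w) = L z * L w) z ?_ (fun x l => ?_)
        (fun z z' h h' => ?_)
      · rw [zero_mul, map_zero, zero_mul]
      · refine induction (P := fun w => L (tmul f 𝓗.t x l * w) = L (tmul f 𝓗.t x l) * L w) w ?_
          (fun x' l' => ?_) (fun z z' h h' => ?_)
        · rw [mul_zero, map_zero, mul_zero]
        · rw [tmul_mul_tmul, hL, hL, hL, _root_.map_mul, _root_.map_mul, _root_.map_mul,
            _root_.map_mul, mul_mul_mul_comm]
        · rw [mul_add, _root_.map_add, h, h', _root_.map_add, mul_add]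
      · rw [add_mul, _root_.map_add, h, h', _root_.map_add, add_mul] }

theorem pairing_tmul {H' : Type*} [CommRing H'] [Algebra k H']
    (f : A →ₐ[k] H') (α : H' →ₙₐ[k] A) (hα : ∀ x a, α (x * f a) = α x * a) (β : H →ₙₐ[k] A)
    (x : H') (l : H) :
    pairing 𝓗 f α hα β (tmul f 𝓗.t x l) = β (𝓗.t (α x)) * β l :=
  pairingAux_tmul f α hα β x l

/-- The map `h ⊗ l ↦ β(t(α(h))) β(l)` on `H ⊗_A H`. -/
noncomputable def pair (α β : LocalBiretraction 𝓗) : 𝓗.T2 →ₙₐ[k] A :=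
  pairing 𝓗 𝓗.s α.toHom α.map_mul_s β.toHom

theorem pair_tmul (α β : LocalBiretraction 𝓗) (h l : H) :
    pair α β (tmul 𝓗.s 𝓗.t h l) = β (𝓗.t (α h)) * β l :=
  pairing_tmul _ _ _ _ h l

/-- The convolution `(α ∗ β)(h) = β(t(α(h₁))) β(h₂)`. -/
noncomputable def conv (α β : LocalBiretraction 𝓗) : H →ₙₐ[k] A :=
  (pair α β).comp (𝓗.Δ : H →ₙₐ[k] 𝓗.T2)

theorem conv_apply (α β : LocalBiretraction 𝓗) (h : H) : conv α β h = pair α β (𝓗.Δ h) := rfl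

theorem conv_one (α β : LocalBiretraction 𝓗) : conv α β 1 = β (𝓗.t (α 1)) := by
  rw [conv_apply, _root_.map_one, one_eq, pair_tmul, mul_map_one]

theorem conv_t (α β : LocalBiretraction 𝓗) (a : A) :
    conv α β (𝓗.t a) = β (𝓗.t (α (𝓗.t a))) := by
  rw [conv_apply, 𝓗.Δ_t, pair_tmul, mul_map_one]

theorem conv_s (α β : LocalBiretraction 𝓗) (a : A) : conv α β (𝓗.s a) = a * conv α β 1 := by
  rw [conv_one, conv_apply, 𝓗.Δ_s, pair_tmul, β.map_s, mul_left_comm, mul_map_one]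

theorem conv_exists_idem (α β : LocalBiretraction 𝓗) :
    ∃ e : A, conv α β (𝓗.t e) = conv α β 1 ∧
      Set.BijOn (fun a => conv α β (𝓗.t a)) (Ideal.span {e}) (Ideal.span {conv α β 1}) := by
  obtain ⟨he, hee⟩ := α.tInv_spec (x := β.e * α 1) (by rw [mul_assoc, mul_map_one])
  set e := α.tInv (β.e * α 1) with he_def
  have h1 : conv α β (𝓗.t e) = conv α β 1 := by
    rw [conv_t, hee, map_t_mul, map_e, mul_comm, mul_map_one, conv_one]
  refine ⟨e, h1, ?_, ?_, ?_⟩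
  · intro x hx
    obtain ⟨r, rfl⟩ := Ideal.mem_span_singleton'.1 hx
    refine Ideal.mem_span_singleton'.2 ⟨conv α β (𝓗.t r), ?_⟩
    change _ = conv α β (𝓗.t (r * e))
    rw [_root_.map_mul, _root_.map_mul, h1]
  · intro x hx y hy hxy
    obtain ⟨r, rfl⟩ := Ideal.mem_span_singleton'.1 hx
    obtain ⟨q, rfl⟩ := Ideal.mem_span_singleton'.1 hy
    change conv α β (𝓗.t (r * e)) = conv α β (𝓗.t (q * e)) at hxy
    rw [conv_t, conv_t] at hxy
    have key : ∀ r, α (𝓗.t (r * e)) * β.e = α (𝓗.t (r * e)) := fun r => by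
      rw [map_t_mul, hee, mul_assoc, mul_right_comm β.e, e_idem]
    have := β.inj (key r) (key q) hxy
    exact α.inj (by rw [mul_assoc, he]) (by rw [mul_assoc, he]) this
  · intro z hz
    obtain ⟨c, rfl⟩ := Ideal.mem_span_singleton'.1 hz
    rw [conv_one]
    obtain ⟨hw, hw'⟩ := β.tInv_spec (x := c * β (𝓗.t (α 1))) (by rw [mul_assoc, mul_map_one])
    set w := β.tInv (c * β (𝓗.t (α 1)))
    obtain ⟨hx, hx'⟩ := α.tInv_spec (x := w * α 1) (by rw [mul_assoc, mul_map_one])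
    refine ⟨α.tInv (w * α 1) * e, Ideal.mem_span_singleton'.2 ⟨_, rfl⟩, ?_⟩
    change conv α β (𝓗.t (_ * e)) = _
    rw [conv_t, map_t_mul α, hx', hee]
    have : w * α 1 * (β.e * α 1) = w * α 1 := by
      rw [mul_mul_mul_comm, hw, mul_map_one]
    rw [this, map_t_mul, hw', mul_assoc, ← map_t_mul, mul_map_one]

noncomputable instance : Mul (LocalBiretraction 𝓗) :=
  ⟨fun α β => ⟨conv α β, conv_s α β, conv_exists_idem α β⟩⟩

theorem mul_apply (α β : LocalBiretraction 𝓗) (h : H) : (α * β) h = pair α β (𝓗.Δ h) := rfl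

/-- The unit is the counit. -/
noncomputable instance : One (LocalBiretraction 𝓗) :=
  ⟨⟨(𝓗.ε : H →ₙₐ[k] A), fun a => by
      change 𝓗.ε (𝓗.s a) = a * 𝓗.ε 1
      rw [𝓗.ε_s, _root_.map_one, mul_one],
    1, by rw [_root_.map_one 𝓗.t], by
      change Set.BijOn (fun a => 𝓗.ε (𝓗.t a)) (Ideal.span {(1 : A)} : Ideal A) (Ideal.span {𝓗.ε 1} : Ideal A)
      rw [_root_.map_one, Ideal.span_singleton_one]
      simp only [𝓗.ε_t]
      exact Set.bijOn_id _⟩⟩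

theorem one_apply (h : H) : (1 : LocalBiretraction 𝓗) h = 𝓗.ε h := rfl

theorem one_mul' (α : LocalBiretraction 𝓗) : 1 * α = α := by
  refine ext' fun h => ?_
  have key : ∀ z, pair 1 α z = α (𝓗.εId z) := fun z => by
    refine induction (P := fun z => pair 1 α z = α (𝓗.εId z)) z ?_ (fun x l => ?_)
      (fun z z' h h' => ?_)
    · rw [map_zero, map_zero]; exact (map_zero α.toHom).symm
    · rw [pair_tmul, one_apply, CommHopfAlgebroidData.εId_tmul, map_mul]
    · rw [_root_.map_add, _root_.map_add, h, h', map_add]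
  rw [mul_apply, key, 𝓗.counit_left]

theorem mul_one' (α : LocalBiretraction 𝓗) : α * 1 = α := by
  refine ext' fun h => ?_
  have key : ∀ z, pair α 1 z = α (𝓗.idε z) := fun z => by
    refine induction (P := fun z => pair α 1 z = α (𝓗.idε z)) z ?_ (fun x l => ?_)
      (fun z z' h h' => ?_)
    · rw [map_zero, map_zero]; exact (map_zero α.toHom).symm
    · rw [pair_tmul, one_apply, one_apply, 𝓗.ε_t, CommHopfAlgebroidData.idε_tmul, map_mul_s]
    · rw [_root_.map_add, _root_.map_add, h, h', map_add]
  rw [mul_apply, key, 𝓗.counit_right]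

theorem pair_mul_s (α β : LocalBiretraction 𝓗) (z : 𝓗.T2) (a : A) :
    pair α β (z * (inr 𝓗.s 𝓗.t).comp 𝓗.s a) = pair α β z * a := by
  rw [_root_.map_mul, AlgHom.comp_apply, inr_apply, pair_tmul, β.map_s]
  refine induction (P := fun z => pair α β z * (β (𝓗.t (α 1)) * (a * β 1)) = pair α β z * a) z ?_
    (fun x l => ?_) (fun z z' h h' => ?_)
  · rw [map_zero, zero_mul, zero_mul]
  · rw [pair_tmul, mul_mul_mul_comm, ← map_t_mul, mul_map_one, mul_left_comm (β l), mul_map_one,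
      mul_assoc, mul_comm a]
  · rw [_root_.map_add, add_mul, h, h', add_mul]

theorem mul_assoc' (α β γ : LocalBiretraction 𝓗) : α * β * γ = α * (β * γ) := by
  let Φ : 𝓗.T3 →ₙₐ[k] A :=
    pairing 𝓗 ((inr 𝓗.s 𝓗.t).comp 𝓗.s) (pair α β) (pair_mul_s α β) γ.toHom
  have hΦ : ∀ (z : 𝓗.T2) (l : H), Φ (tmul _ _ z l) = γ (𝓗.t (pair α β z)) * γ l := fun z l =>
    pairing_tmul _ _ _ _ z l
  have h1 : ∀ z, pair (α * β) γ z = Φ (𝓗.ΔId z) := fun z => by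
    refine induction (P := fun z => pair (α * β) γ z = Φ (𝓗.ΔId z)) z ?_ (fun x l => ?_)
      (fun z z' h h' => ?_)
    · rw [map_zero, map_zero, map_zero]
    · rw [pair_tmul, CommHopfAlgebroidData.ΔId, lift_tmul, AlgHom.comp_apply, ← tmul_eq, hΦ,
        mul_apply]
    · rw [_root_.map_add, _root_.map_add, _root_.map_add, h, h']
  have h2 : ∀ w, Φ (𝓗.oneTmul w) = γ (𝓗.t (β (𝓗.t (α 1)))) * pair β γ w := fun w => by
    refine induction (P := fun w => Φ (𝓗.oneTmul w) = γ (𝓗.t (β (𝓗.t (α 1)))) * pair β γ w) w ?_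
      (fun x l => ?_) (fun z z' h h' => ?_)
    · rw [map_zero, map_zero, map_zero, mul_zero]
    · rw [CommHopfAlgebroidData.oneTmul_tmul, hΦ, pair_tmul, pair_tmul, map_t_mul, mul_assoc]
    · rw [_root_.map_add, _root_.map_add, _root_.map_add, h, h', mul_add]
  have h3 : ∀ z, pair α (β * γ) z = Φ (𝓗.idΔ z) := fun z => by
    refine induction (P := fun z => pair α (β * γ) z = Φ (𝓗.idΔ z)) z ?_ (fun x l => ?_)
      (fun z z' h h' => ?_)
    · rw [map_zero, map_zero, map_zero]
    · rw [pair_tmul, CommHopfAlgebroidData.idΔ, lift_tmul, AlgHom.comp_apply, AlgHom.comp_apply,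
        _root_.map_mul, h2, inl_apply (f := (inr 𝓗.s 𝓗.t).comp 𝓗.s), hΦ, inl_apply, pair_tmul,
        mul_map_one, mul_map_one, ← mul_assoc, ← map_t_mul, ← map_t_mul, mul_map_one,
        mul_apply, mul_apply, 𝓗.Δ_t, pair_tmul, mul_map_one]
    · rw [_root_.map_add, _root_.map_add, _root_.map_add, h, h']
  refine ext' fun h => ?_
  rw [mul_apply, mul_apply, h1, h3, 𝓗.coassoc]

section pinv

variable (α : LocalBiretraction 𝓗)

theorem tInv_mul (x : H) : α.tInv (α x) * α.e = α.tInv (α x) :=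
  (α.tInv_spec (α.mul_map_one x)).1

theorem map_tInv (x : H) : α (𝓗.t (α.tInv (α x))) = α x :=
  (α.tInv_spec (α.mul_map_one x)).2

theorem tInv_eq {x : H} {y : A} (hy : y * α.e = y) (h : α (𝓗.t y) = α x) : α.tInv (α x) = y :=
  α.inj (α.tInv_mul x) hy ((α.map_tInv x).trans h.symm)

/-- `α* = (α ∘ t)⁻¹ ∘ α ∘ S`. -/
noncomputable def pinvHom : H →ₙₐ[k] A where
  toFun h := α.tInv (α (𝓗.S h))
  map_smul' c h := α.tInv_eq
    (by change c • _ * _ = c • _; rw [smul_mul_assoc, tInv_mul])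
    (by
      change α (𝓗.t (c • _)) = _
      rw [map_smul 𝓗.t, map_smul 𝓗.S, map_smul α.toHom, map_smul α.toHom, map_tInv])
  map_zero' := α.tInv_eq (zero_mul _)
    (by rw [map_zero 𝓗.t, map_zero 𝓗.S, map_zero α.toHom])
  map_add' x y := α.tInv_eq (by rw [add_mul, tInv_mul, tInv_mul])
    (by rw [_root_.map_add 𝓗.t, _root_.map_add 𝓗.S, map_add, map_add, map_tInv, map_tInv])
  map_mul' x y := α.tInv_eq (by rw [mul_assoc, tInv_mul])
    (by rw [map_t_mul, map_tInv, map_tInv, _root_.map_mul, map_mul])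

theorem pinvHom_apply (h : H) : α.pinvHom h = α.tInv (α (𝓗.S h)) := rfl

theorem pinvHom_one : α.pinvHom 1 = α.e :=
  α.tInv_eq α.e_idem (by rw [map_e, _root_.map_one 𝓗.S])

theorem pinvHom_s (a : A) : α.pinvHom (𝓗.s a) = a * α.pinvHom 1 := by
  rw [pinvHom_one, pinvHom_apply]
  exact α.tInv_eq (by rw [mul_assoc, e_idem]) (by rw [map_t_mul, map_e, mul_map_one, 𝓗.S_s])

theorem pinvHom_t (a : A) : α.pinvHom (𝓗.t a) = α.tInv (a * α 1) := by
  rw [pinvHom_apply, 𝓗.S_t, α.map_s]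

/-- The pseudo-inverse. -/
noncomputable def pinv : LocalBiretraction 𝓗 where
  toHom := α.pinvHom
  map_s := α.pinvHom_s
  exists_idem := by
    refine ⟨α 1, ?_, ?_, ?_, ?_⟩
    · rw [pinvHom_t, pinvHom_one, ← map_mul, mul_one]
      exact α.tInv_eq α.e_idem α.map_e
    · intro x hx
      rw [pinvHom_one]
      change α.pinvHom (𝓗.t x) ∈ Ideal.span {α.e}
      rw [mem_e_iff, pinvHom_apply, tInv_mul]
    · intro x hx y hy hxy
      rw [SetLike.mem_coe, mem_one_iff] at hx hy
      change α.pinvHom (𝓗.t x) = α.pinvHom (𝓗.t y) at hxy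
      rw [pinvHom_t, pinvHom_t, hx, hy] at hxy
      rw [← (α.tInv_spec hx).2, hxy, (α.tInv_spec hy).2]
    · intro z hz
      rw [pinvHom_one, SetLike.mem_coe, mem_e_iff] at hz
      refine ⟨α (𝓗.t z), (α.mem_one_iff _).2 (α.mul_map_one _), ?_⟩
      change α.pinvHom (𝓗.t _) = z
      rw [pinvHom_t, mul_map_one]
      exact α.tInv_eq hz rfl

theorem pinv_apply (h : H) : α.pinv h = α.tInv (α (𝓗.S h)) := rfl

theorem pinv_mul_apply (h : H) : (α.pinv * α) h = 𝓗.ε h * α 1 := by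
  have key : ∀ z, pair α.pinv α z = α (𝓗.SId z) := fun z => by
    refine induction (P := fun z => pair α.pinv α z = α (𝓗.SId z)) z ?_ (fun x l => ?_)
      (fun z z' h h' => ?_)
    · rw [map_zero, map_zero]; exact (map_zero α.toHom).symm
    · rw [pair_tmul, pinv_apply, map_tInv, CommHopfAlgebroidData.SId_tmul, map_mul]
    · rw [_root_.map_add, _root_.map_add, h, h', map_add]
  rw [mul_apply, key, 𝓗.antipode_left, α.map_s]

theorem mul_pinv_mul' : α * α.pinv * α = α := by
  rw [mul_assoc']
  refine ext' fun h => ?_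
  have key : ∀ z, pair α (α.pinv * α) z = α (𝓗.idε z) := fun z => by
    refine induction (P := fun z => pair α (α.pinv * α) z = α (𝓗.idε z)) z ?_ (fun x l => ?_)
      (fun z z' h h' => ?_)
    · rw [map_zero, map_zero]; exact (map_zero α.toHom).symm
    · rw [pair_tmul, pinv_mul_apply, pinv_mul_apply, 𝓗.ε_t, CommHopfAlgebroidData.idε_tmul,
        mul_map_one, ← mul_assoc, mul_right_comm, mul_map_one, map_mul_s]
    · rw [_root_.map_add, _root_.map_add, h, h', map_add]
  rw [mul_apply, key, 𝓗.counit_right]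

theorem pinv_mul_pinv' : α.pinv * α * α.pinv = α.pinv := by
  refine ext' fun h => ?_
  have key : ∀ z, pair (α.pinv * α) α.pinv z = α.pinv (𝓗.εId z) := fun z => by
    refine induction (P := fun z => pair (α.pinv * α) α.pinv z = α.pinv (𝓗.εId z)) z ?_
      (fun x l => ?_) (fun z z' h h' => ?_)
    · rw [map_zero, map_zero]; exact (map_zero α.pinv.toHom).symm
    · have h1 : α.pinv (𝓗.t (α 1)) = α.e := by
        change α.pinvHom _ = _
        rw [pinvHom_t, ← map_mul, mul_one]
        exact α.tInv_eq α.e_idem α.map_e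
      have h2 : α.pinv l * α.e = α.pinv l := α.tInv_mul _
      rw [pair_tmul, pinv_mul_apply, map_t_mul, h1, mul_assoc, mul_comm α.e, h2,
        CommHopfAlgebroidData.εId_tmul, map_mul]
    · rw [_root_.map_add, _root_.map_add, h, h', map_add]
  rw [mul_apply, key, 𝓗.counit_left]

end pinv

noncomputable instance : RegularMonoid (LocalBiretraction 𝓗) where
  mul_assoc := mul_assoc'
  one_mul := one_mul'
  mul_one := mul_one'
  pinv := pinv
  mul_pinv_mul := mul_pinv_mul'
  pinv_mul_pinv := pinv_mul_pinv'

end LocalBiretraction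

/-! ### Local bisections of a groupoid -/

open CategoryTheory in
/-- A local bisection `(u, X)` of a groupoid: a set `X` of objects and for every `x ∈ X` an arrow
`u(x)` with source `x` and some target `t(u(x))`, such that `t ∘ u` is injective on `X`
(i.e. bijective onto its image). The value of `u` at `x` is stored as the pair of the target and
the arrow `x ⟶ t(u(x))`. -/
structure LocalBisection (V : Type*) [Groupoid V] where
  dom : Set V
  u : ∀ x ∈ dom, Σ y : V, (x ⟶ y)
  inj : ∀ x hx x' hx', (u x hx).1 = (u x' hx').1 → x = x'

namespace LocalBisection

open CategoryTheory

variable {V : Type*} [Groupoid V]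

/-- `t(u(x))`. -/
def tgt (b : LocalBisection V) (x : V) (hx : x ∈ b.dom) : V := (b.u x hx).1

/-- The arrow `u(x)`. -/
def arr (b : LocalBisection V) (x : V) (hx : x ∈ b.dom) : x ⟶ b.tgt x hx := (b.u x hx).2

theorem ext' {b c : LocalBisection V} (h : ∀ x, x ∈ b.dom ↔ x ∈ c.dom)
    (hu : ∀ x hb hc, b.u x hb = c.u x hc) : b = c := by
  obtain ⟨X, u, _⟩ := b
  obtain ⟨Y, v, _⟩ := c
  obtain rfl : X = Y := Set.ext h
  obtain rfl : u = v := by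
    funext x hx
    exact hu x hx hx
  rfl

/-- The product `(u, X) (v, Y)`: its domain consists of the `y ∈ Y` with `t(v(y)) ∈ X`, and
`(uv)(y) = u(t(v(y))) v(y)`. (In the category notation, `f ≫ g` is the product `g f`.) -/
instance : Mul (LocalBisection V) where
  mul b c :=
    { dom := {y | ∃ hy : y ∈ c.dom, c.tgt y hy ∈ b.dom}
      u := fun y hy => ⟨b.tgt (c.tgt y hy.1) hy.2, c.arr y hy.1 ≫ b.arr (c.tgt y hy.1) hy.2⟩
      inj := fun x hx x' hx' h => c.inj x hx.1 x' hx'.1 (b.inj _ hx.2 _ hx'.2 h) }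

/-- The unit `(i, 𝒢⁰)`. -/
instance : One (LocalBisection V) where
  one :=
    { dom := Set.univ
      u := fun x _ => ⟨x, 𝟙 x⟩
      inj := fun _ _ _ _ h => h }

/-- The pseudo-inverse `(ū, t(u(X)))`, `ū(t(u(x))) = u(x)⁻¹`. -/
noncomputable def pinv (b : LocalBisection V) : LocalBisection V where
  dom := {y | ∃ x, ∃ hx : x ∈ b.dom, b.tgt x hx = y}
  u y hy := ⟨hy.choose, eqToHom hy.choose_spec.choose_spec.symm ≫
    Groupoid.inv (b.arr hy.choose hy.choose_spec.choose)⟩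
  inj y hy y' hy' h := by
    change hy.choose = hy'.choose at h
    rw [← hy.choose_spec.choose_spec, ← hy'.choose_spec.choose_spec]
    congr 1

theorem pinv_u (b : LocalBisection V) (x : V) (hx : x ∈ b.dom)
    (hy : b.tgt x hx ∈ b.pinv.dom) :
    b.pinv.u (b.tgt x hx) hy = ⟨x, Groupoid.inv (b.arr x hx)⟩ := by
  have key : ∀ (z : V) (hz : z ∈ b.dom) (e : b.tgt z hz = b.tgt x hx),
      (⟨z, eqToHom e.symm ≫ Groupoid.inv (b.arr z hz)⟩ : Σ y : V, (b.tgt x hx ⟶ y)) =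
        ⟨x, Groupoid.inv (b.arr x hx)⟩ := by
    intro z hz e
    obtain rfl : z = x := b.inj _ _ _ _ e
    simp
  exact key _ hy.choose_spec.choose hy.choose_spec.choose_spec

theorem tgt_pinv (b : LocalBisection V) (x : V) (hx : x ∈ b.dom)
    (hy : b.tgt x hx ∈ b.pinv.dom) : b.pinv.tgt (b.tgt x hx) hy = x := by
  rw [tgt, pinv_u]

theorem mul_u (b c : LocalBisection V) (x : V) (h : x ∈ (b * c).dom) {y : V} {f : x ⟶ y}
    {z : V} {g : y ⟶ z} (hc : c.u x h.1 = ⟨y, f⟩) (hy : y ∈ b.dom) (hb : b.u y hy = ⟨z, g⟩) :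
    (b * c).u x h = ⟨z, f ≫ g⟩ := by
  obtain ⟨h1, h2⟩ := h
  have key : ∀ (p : Σ y : V, (x ⟶ y)) (hp : p.1 ∈ b.dom), p = ⟨y, f⟩ →
      (⟨(b.u p.1 hp).1, p.2 ≫ (b.u p.1 hp).2⟩ : Σ y : V, (x ⟶ y)) = ⟨z, f ≫ g⟩ := by
    rintro p hp rfl
    have : b.u y hp = ⟨z, g⟩ := hb
    change (⟨(b.u y hp).1, f ≫ (b.u y hp).2⟩ : Σ y : V, (x ⟶ y)) = _
    rw [this]
  exact key (c.u x h1) h2 hc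

noncomputable instance : RegularMonoid (LocalBisection V) where
  mul_assoc b c d := ext'
    (fun x => ⟨fun ⟨h1, h2, h3⟩ => ⟨⟨h1, h2⟩, h3⟩, fun ⟨⟨h1, h2⟩, h3⟩ => ⟨h1, h2, h3⟩⟩)
    (fun x hb hc => congrArg (Sigma.mk _) (Category.assoc _ _ _).symm)
  one_mul b := ext' (fun x => ⟨fun h => h.1, fun h => ⟨h, trivial⟩⟩)
    (fun x hb hc => congrArg (Sigma.mk _) (Category.comp_id _))
  mul_one b := ext' (fun x => ⟨fun h => h.2, fun h => ⟨trivial, h⟩⟩)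
    (fun x hb hc => congrArg (Sigma.mk _) (Category.id_comp _))
  pinv := pinv
  mul_pinv_mul b := ext'
    (fun x => ⟨fun h => h.1, fun h =>
      have h1 : b.tgt x h ∈ b.pinv.dom := ⟨x, h, rfl⟩
      ⟨h, h1, show b.pinv.tgt _ h1 ∈ b.dom from (b.tgt_pinv x h h1).symm ▸ h⟩⟩)
    (fun x hb hc => by
      have h1 : b.tgt x hc ∈ b.pinv.dom := ⟨x, hc, rfl⟩
      have h2 : x ∈ (b * b.pinv * b).dom := hb
      refine (mul_u _ _ x hb (y := b.tgt x hc) (f := b.arr x hc) (z := b.tgt x hc)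
        (g := 𝟙 _) rfl hb.2 ?_).trans ?_
      · refine (mul_u _ _ _ _ (b.pinv_u x hc h1) hc rfl).trans ?_
        exact congrArg (Sigma.mk (b.tgt x hc)) (Groupoid.inv_comp (b.arr x hc))
      · rw [Category.comp_id]
        rfl)
  pinv_mul_pinv b := ext'
    (fun y => ⟨fun h => h.1, fun h => ⟨h, by
      obtain ⟨x, hx, rfl⟩ := h
      have h1 : b.tgt x hx ∈ b.pinv.dom := ⟨x, hx, rfl⟩
      have h2 : x ∈ (b.pinv * b).dom := ⟨hx, h1⟩
      change b.pinv.tgt _ h1 ∈ (b.pinv * b).dom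
      exact (b.tgt_pinv x hx h1).symm ▸ h2⟩⟩)
    (fun y hb hc => by
      obtain ⟨x, hx, rfl⟩ := hc
      have h1 : b.tgt x hx ∈ b.pinv.dom := ⟨x, hx, rfl⟩
      have h2 : x ∈ (b.pinv * b).dom := ⟨hx, h1⟩
      refine Eq.trans ?_ (b.pinv_u x hx h1).symm
      refine (mul_u _ _ _ hb (b.pinv_u x hx h1) h2
        (mul_u _ _ x h2 (y := b.tgt x hx) (f := b.arr x hx) rfl h1 (b.pinv_u x hx h1))).trans ?_
      rw [Groupoid.comp_inv, Category.comp_id])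

end LocalBisection

/-! ### Representations of a groupoid and representative functions -/

universe w v u

open CategoryTheory

/-- A finite-dimensional representation of a groupoid with object set `V`: vector spaces `E x` of
a common dimension with frames `k^n ≃ E x`, and functorial linear isomorphisms
`ρ g : E (s g) → E (t g)`. (In the category notation `f ≫ g` is the product `g f`.) -/
structure GroupoidRep (k : Type w) [Field k] (V : Type u) [Groupoid.{v} V] where
  E : V → Type w
  [acg : ∀ x, AddCommGroup (E x)]
  [mod : ∀ x, Module k (E x)]
  dim : ℕ
  frame : ∀ x, (Fin dim → k) ≃ₗ[k] E x
  ρ : ∀ {x y : V}, (x ⟶ y) → E x ≃ₗ[k] E y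
  ρ_id : ∀ x, ρ (𝟙 x) = LinearEquiv.refl k (E x)
  ρ_comp : ∀ {x y z : V} (f : x ⟶ y) (g : y ⟶ z), ρ (f ≫ g) = (ρ f).trans (ρ g)

namespace GroupoidRep

attribute [instance] acg mod

variable {k : Type w} [Field k] {V : Type u} [Groupoid.{v} V]

theorem ρ_id_apply (E : GroupoidRep k V) (x : V) (p : E.E x) : E.ρ (𝟙 x) p = p := by
  rw [ρ_id]; rfl

theorem ρ_comp_apply (E : GroupoidRep k V) {x y z : V} (f : x ⟶ y) (g : y ⟶ z) (p : E.E x) :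
    E.ρ (f ≫ g) p = E.ρ g (E.ρ f p) := by
  rw [ρ_comp]; rfl

theorem ρ_inv_ρ (E : GroupoidRep k V) {x y : V} (f : x ⟶ y) (p : E.E x) :
    E.ρ (Groupoid.inv f) (E.ρ f p) = p := by
  rw [← ρ_comp_apply, Groupoid.comp_inv, ρ_id_apply]

theorem ρ_ρ_inv (E : GroupoidRep k V) {x y : V} (f : x ⟶ y) (p : E.E y) :
    E.ρ f (E.ρ (Groupoid.inv f) p) = p := by
  rw [← ρ_comp_apply, Groupoid.inv_comp, ρ_id_apply]

/-- Sections of `E`: the module `Γ(E)`. -/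
abbrev Sec (E : GroupoidRep k V) : Type _ := ∀ x, E.E x

/-- Sections of the dual bundle: the module `Γ(E*)`. -/
abbrev DSec (E : GroupoidRep k V) : Type _ := ∀ x, Module.Dual k (E.E x)

/-- The basis of `E x` given by the frame. -/
noncomputable def basis (E : GroupoidRep k V) (x : V) : Module.Basis (Fin E.dim) k (E.E x) :=
  Module.Basis.ofEquivFun (E.frame x).symm

/-- The section `e_i`. -/
noncomputable def b (E : GroupoidRep k V) (i : Fin E.dim) : E.Sec := fun x => E.basis x i

/-- The dual section `e_i*`. -/
noncomputable def c (E : GroupoidRep k V) (i : Fin E.dim) : E.DSec := fun x => (E.basis x).coord i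

theorem sum_c_smul_b (E : GroupoidRep k V) (x : V) (p : E.E x) :
    ∑ i, E.c i x p • E.b i x = p := (E.basis x).sum_repr p

theorem sum_smul_c (E : GroupoidRep k V) (x : V) (φ : Module.Dual k (E.E x)) :
    ∑ i, φ (E.b i x) • E.c i x = φ := by
  ext p
  conv_rhs => rw [← E.sum_c_smul_b x p]
  simp [mul_comm]

/-- Morphisms of representations. -/
structure Hom (E F : GroupoidRep k V) where
  app : ∀ x, E.E x →ₗ[k] F.E x
  comm : ∀ {x y : V} (g : x ⟶ y) (p : E.E x), F.ρ g (app x p) = app y (E.ρ g p)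

/-- `λ p` for a section `p` of `E`. -/
def Hom.onSec {E F : GroupoidRep k V} (h : Hom E F) (p : E.Sec) : F.Sec := fun x => h.app x (p x)

/-- `φ λ` for a section `φ` of `F*`. -/
def Hom.onDSec {E F : GroupoidRep k V} (h : Hom E F) (φ : F.DSec) : E.DSec :=
  fun x => φ x ∘ₗ h.app x

/-- The trivial representation. -/
abbrev triv (k : Type w) [Field k] (V : Type u) [Groupoid.{v} V] : GroupoidRep k V where
  E _ := k
  dim := 1
  frame _ := LinearEquiv.funUnique (Fin 1) k k
  ρ _ := LinearEquiv.refl k k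
  ρ_id _ := rfl
  ρ_comp _ _ := rfl

/-- The tensor product of representations. -/
noncomputable abbrev tensor (E F : GroupoidRep k V) : GroupoidRep k V where
  E x := E.E x ⊗[k] F.E x
  dim := E.dim * F.dim
  frame x := (((E.basis x).tensorProduct (F.basis x)).reindex finProdFinEquiv).equivFun.symm
  ρ g := TensorProduct.congr (E.ρ g) (F.ρ g)
  ρ_id x := by rw [ρ_id, ρ_id, TensorProduct.congr_refl_refl]
  ρ_comp f g := by rw [ρ_comp, ρ_comp, TensorProduct.congr_trans]

/-- The dual representation, `ρ*_g φ = φ ∘ ρ_{g⁻¹}`. -/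
noncomputable abbrev dual (E : GroupoidRep k V) : GroupoidRep k V where
  E x := Module.Dual k (E.E x)
  dim := E.dim
  frame x := (E.basis x).dualBasis.equivFun.symm
  ρ g := (E.ρ (Groupoid.inv g)).dualMap
  ρ_id x := by
    ext φ p
    change φ (E.ρ (Groupoid.inv (𝟙 x)) p) = φ p
    rw [Groupoid.inv_eq_inv, IsIso.inv_id, ρ_id_apply]
  ρ_comp f g := by
    ext φ p
    change φ (E.ρ (Groupoid.inv (f ≫ g)) p) =
      φ (E.ρ (Groupoid.inv f) (E.ρ (Groupoid.inv g) p))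
    rw [← ρ_comp_apply, Groupoid.inv_eq_inv, IsIso.inv_comp, Groupoid.inv_eq_inv,
      Groupoid.inv_eq_inv]

/-- The section `p ⊗_A q` of `E ⊗ F`. -/
noncomputable def tmulSec (E F : GroupoidRep k V) : E.Sec →ₗ[k] F.Sec →ₗ[k] (E.tensor F).Sec :=
  LinearMap.mk₂ k (fun p q x => p x ⊗ₜ[k] q x)
    (fun _ _ _ => funext fun _ => TensorProduct.add_tmul _ _ _)
    (fun _ _ _ => funext fun _ => TensorProduct.smul_tmul' _ _ _)
    (fun _ _ _ => funext fun _ => TensorProduct.tmul_add _ _ _)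
    (fun _ _ _ => funext fun _ => TensorProduct.tmul_smul _ _ _)

/-- The section `φ ⊗_A ψ` of `(E ⊗ F)*`: `(φ ⊗ ψ)(p ⊗ q) = φ(p) ψ(q)`. -/
noncomputable def tmulDSec (E F : GroupoidRep k V) :
    E.DSec →ₗ[k] F.DSec →ₗ[k] (E.tensor F).DSec :=
  LinearMap.mk₂ k (fun φ ψ x => TensorProduct.dualDistrib k (E.E x) (F.E x) (φ x ⊗ₜ[k] ψ x))
    (fun φ φ' ψ => funext fun x => by
      change _ = TensorProduct.dualDistrib k (E.E x) (F.E x) (φ x ⊗ₜ[k] ψ x) +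
        TensorProduct.dualDistrib k (E.E x) (F.E x) (φ' x ⊗ₜ[k] ψ x)
      rw [← map_add, ← TensorProduct.add_tmul]; rfl)
    (fun r φ ψ => funext fun x => by
      change _ = r • TensorProduct.dualDistrib k (E.E x) (F.E x) (φ x ⊗ₜ[k] ψ x)
      rw [← map_smul, TensorProduct.smul_tmul']; rfl)
    (fun φ ψ ψ' => funext fun x => by
      change _ = TensorProduct.dualDistrib k (E.E x) (F.E x) (φ x ⊗ₜ[k] ψ x) +
        TensorProduct.dualDistrib k (E.E x) (F.E x) (φ x ⊗ₜ[k] ψ' x)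
      rw [← map_add, ← TensorProduct.tmul_add]; rfl)
    (fun r φ ψ => funext fun x => by
      change _ = r • TensorProduct.dualDistrib k (E.E x) (F.E x) (φ x ⊗ₜ[k] ψ x)
      rw [← map_smul, ← TensorProduct.tmul_smul]; rfl)

theorem tmulSec_apply (E F : GroupoidRep k V) (p : E.Sec) (q : F.Sec) (x : V) :
    tmulSec E F p q x = p x ⊗ₜ[k] q x := rfl

theorem tmulDSec_apply (E F : GroupoidRep k V) (φ : E.DSec) (ψ : F.DSec) (x : V)
    (p : E.E x) (q : F.E x) : tmulDSec E F φ ψ x (p ⊗ₜ[k] q) = φ x p * ψ x q :=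
  TensorProduct.dualDistrib_apply _ _ _ _

theorem tmulDSec_eq (E F : GroupoidRep k V) (φ : E.DSec) (ψ : F.DSec) (x : V)
    (g : E.E x ⊗[k] F.E x →ₗ[k] k) (h : ∀ p q, g (p ⊗ₜ[k] q) = φ x p * ψ x q)
    (v : E.E x ⊗[k] F.E x) : g v = tmulDSec E F φ ψ x v :=
  LinearMap.congr_fun (TensorProduct.ext' fun p q =>
    (h p q).trans (tmulDSec_apply E F φ ψ x p q).symm) v

theorem tensor_ρ_tmul (E F : GroupoidRep k V) {x y : V} (g : x ⟶ y) (p : E.E x) (q : F.E x) :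
    (E.tensor F).ρ g (p ⊗ₜ[k] q) = E.ρ g p ⊗ₜ[k] F.ρ g q := rfl

/-- Two sections of `(E ⊗ F)*` agreeing on pure tensors are equal. -/
theorem tensor_dsec_ext {E F : GroupoidRep k V} {φ ψ : (E.tensor F).DSec}
    (h : ∀ x (p : E.E x) (q : F.E x), φ x (p ⊗ₜ[k] q) = ψ x (p ⊗ₜ[k] q)) : φ = ψ :=
  funext fun x => TensorProduct.ext' (h x)

theorem tensor_basis (E F : GroupoidRep k V) (x : V) :
    (E.tensor F).basis x = ((E.basis x).tensorProduct (F.basis x)).reindex finProdFinEquiv :=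
  (congrArg Module.Basis.ofEquivFun (LinearEquiv.symm_symm _)).trans
    (Module.Basis.ofEquivFun_equivFun _)

theorem tensor_b (E F : GroupoidRep k V) (i : Fin E.dim) (j : Fin F.dim) :
    (E.tensor F).b (finProdFinEquiv (i, j)) = tmulSec E F (E.b i) (F.b j) := by
  funext x
  change (E.tensor F).basis x (finProdFinEquiv (i, j)) = tmulSec E F (E.b i) (F.b j) x
  rw [tensor_basis]
  exact (Module.Basis.reindex_apply _ _ _).trans
    ((congrArg _ (Equiv.symm_apply_apply _ _)).trans (Module.Basis.tensorProduct_apply _ _ _ _))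

theorem tensor_c (E F : GroupoidRep k V) (i : Fin E.dim) (j : Fin F.dim) :
    (E.tensor F).c (finProdFinEquiv (i, j)) = tmulDSec E F (E.c i) (F.c j) := by
  refine tensor_dsec_ext fun x p q => ?_
  rw [tmulDSec_apply]
  change ((E.tensor F).basis x).repr (p ⊗ₜ[k] q) (finProdFinEquiv (i, j)) = _
  rw [tensor_basis]
  refine (Module.Basis.repr_reindex_apply _ _ _ _).trans ?_
  refine (congrArg _ (Equiv.symm_apply_apply _ _)).trans
    ((Module.Basis.tensorProduct_repr_tmul_apply _ _ _ _ _ _).trans ?_)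
  exact mul_comm _ _

/-! Morphisms of representations used for the algebra structure. -/

/-- A morphism out of a tensor product, checked on pure tensors. -/
noncomputable def tensorHom {E F G : GroupoidRep k V} (app : ∀ x, E.E x ⊗[k] F.E x →ₗ[k] G.E x)
    (h : ∀ {x y : V} (g : x ⟶ y) (p : E.E x) (q : F.E x),
      G.ρ g (app x (p ⊗ₜ[k] q)) = app y (E.ρ g p ⊗ₜ[k] F.ρ g q)) : Hom (E.tensor F) G where
  app := app
  comm {x y} g p := by
    have : (G.ρ g).toLinearMap ∘ₗ app x =
        app y ∘ₗ (TensorProduct.congr (E.ρ g) (F.ρ g)).toLinearMap :=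
      TensorProduct.ext' fun p q => h g p q
    exact LinearMap.congr_fun this p

/-- `E ⊗ F → F ⊗ E`. -/
noncomputable def swapHom (E F : GroupoidRep k V) : Hom (E.tensor F) (F.tensor E) :=
  tensorHom (fun x => (TensorProduct.comm k (E.E x) (F.E x)).toLinearMap) fun _ _ _ => rfl

/-- `(E ⊗ F) ⊗ G → E ⊗ (F ⊗ G)`. -/
noncomputable def assocHom (E F G : GroupoidRep k V) :
    Hom ((E.tensor F).tensor G) (E.tensor (F.tensor G)) where
  app x := (TensorProduct.assoc k (E.E x) (F.E x) (G.E x)).toLinearMap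
  comm {x y} g p := by
    have : ((E.tensor (F.tensor G)).ρ g).toLinearMap ∘ₗ
          (TensorProduct.assoc k (E.E x) (F.E x) (G.E x)).toLinearMap =
        (TensorProduct.assoc k (E.E y) (F.E y) (G.E y)).toLinearMap ∘ₗ
          (((E.tensor F).tensor G).ρ g).toLinearMap :=
      TensorProduct.ext_threefold fun p q r => rfl
    exact LinearMap.congr_fun this p

/-- `I ⊗ E → E`. -/
noncomputable def lidHom (E : GroupoidRep k V) : Hom ((triv k V).tensor E) E :=
  tensorHom (E := triv k V) (fun x => (TensorProduct.lid k (E.E x)).toLinearMap)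
    fun {x y} g (c : k) p => by
      change E.ρ g (c • p) = c • E.ρ g p
      rw [map_smul]

/-- `λ ⊗ id : E ⊗ G → F ⊗ G`. -/
noncomputable def Hom.rTensor {E F : GroupoidRep k V} (h : Hom E F) (G : GroupoidRep k V) :
    Hom (E.tensor G) (F.tensor G) :=
  tensorHom (fun x => LinearMap.rTensor (G.E x) (h.app x)) fun {x y} g p q => by
    change F.ρ g (h.app x p) ⊗ₜ[k] G.ρ g q = h.app y (E.ρ g p) ⊗ₜ[k] G.ρ g q
    rw [h.comm]

/-- `id ⊗ λ : G ⊗ E → G ⊗ F`. -/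
noncomputable def Hom.lTensor {E F : GroupoidRep k V} (h : Hom E F) (G : GroupoidRep k V) :
    Hom (G.tensor E) (G.tensor F) :=
  tensorHom (fun x => LinearMap.lTensor (G.E x) (h.app x)) fun {x y} g p q => by
    change G.ρ g p ⊗ₜ[k] F.ρ g (h.app x q) = G.ρ g p ⊗ₜ[k] h.app y (E.ρ g q)
    rw [h.comm]

/-- The transpose `F* → E*`. -/
noncomputable def Hom.transpose {E F : GroupoidRep k V} (h : Hom E F) : Hom F.dual E.dual where
  app x := (h.app x).dualMap
  comm {x y} g (φ : Module.Dual k (F.E x)) := by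
    refine LinearMap.ext fun p : E.E y => ?_
    change φ (h.app x (E.ρ (Groupoid.inv g) p)) = φ (F.ρ (Groupoid.inv g) (h.app y p))
    rw [h.comm]

/-- `E* ⊗ F* → (E ⊗ F)*`. -/
noncomputable def dualTensorHom (E F : GroupoidRep k V) :
    Hom (E.dual.tensor F.dual) (E.tensor F).dual :=
  tensorHom (E := E.dual) (F := F.dual) (G := (E.tensor F).dual)
    (fun x => TensorProduct.dualDistrib k (E.E x) (F.E x))
    fun _ _ _ => TensorProduct.ext' fun _ _ => rfl

/-- `I → I*`. -/
noncomputable def trivDualHom (k : Type w) [Field k] (V : Type u) [Groupoid.{v} V] :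
    Hom (triv k V) (triv k V).dual where
  app _ := LinearMap.toSpanSingleton k (Module.Dual k k) LinearMap.id
  comm _ _ := rfl

/-- The evaluation `E* ⊗ E → I`. -/
noncomputable def evHom (E : GroupoidRep k V) : Hom (E.dual.tensor E) (triv k V) :=
  tensorHom (E := E.dual) (G := triv k V) (fun x => contractLeft k (E.E x))
    fun {x y} g (φ : Module.Dual k (E.E x)) p => by
      change φ p = φ (E.ρ (Groupoid.inv g) (E.ρ g p))
      rw [ρ_inv_ρ]

/-- The coevaluation `I → E ⊗ E*`. -/
noncomputable def coevHom (E : GroupoidRep k V) : Hom (triv k V) (E.tensor E.dual) where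
  app x := LinearMap.toSpanSingleton k (E.E x ⊗[k] Module.Dual k (E.E x))
    (∑ i, E.b i x ⊗ₜ[k] E.c i x)
  comm {x y} g (r : k) := by
    have key : TensorProduct.congr (E.ρ g) (E.ρ (Groupoid.inv g)).dualMap
        (∑ i, E.b i x ⊗ₜ[k] E.c i x) = ∑ i, E.b i y ⊗ₜ[k] E.c i y := by
      have h1 : ∀ i, E.ρ g (E.b i x) ⊗ₜ[k] (E.ρ (Groupoid.inv g)).dualMap (E.c i x) =
          ∑ j, (E.c i x (E.ρ (Groupoid.inv g) (E.b j y)) • E.ρ g (E.b i x)) ⊗ₜ[k] E.c j y := by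
        intro i
        conv_lhs => rw [← E.sum_smul_c y ((E.ρ (Groupoid.inv g)).dualMap (E.c i x))]
        rw [TensorProduct.tmul_sum]
        exact Finset.sum_congr rfl fun j _ => (TensorProduct.smul_tmul _ _ _).symm
      rw [map_sum]
      simp only [TensorProduct.congr_tmul]
      rw [Finset.sum_congr rfl fun i _ => h1 i, Finset.sum_comm]
      refine Finset.sum_congr rfl fun j _ => ?_
      rw [← TensorProduct.sum_tmul]
      congr 1
      simp only [← map_smul]
      rw [← map_sum, sum_c_smul_b, ρ_ρ_inv]
    change TensorProduct.congr (E.ρ g) (E.ρ (Groupoid.inv g)).dualMap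
        (r • ∑ i, E.b i x ⊗ₜ[k] E.c i x) = r • ∑ i, E.b i y ⊗ₜ[k] E.c i y
    rw [map_smul, key]

end GroupoidRep

/-- The summand `Γ(E*) ⊗ Γ(E)`. -/
def GroupoidRep.Summand {k : Type w} [Field k] {V : Type u} [Groupoid.{v} V]
    (E : GroupoidRep k V) : Type (max u w) := E.DSec ⊗[k] E.Sec

noncomputable instance {k : Type w} [Field k] {V : Type u} [Groupoid.{v} V]
    (E : GroupoidRep k V) : AddCommGroup E.Summand :=
  inferInstanceAs (AddCommGroup (E.DSec ⊗[k] E.Sec))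

noncomputable instance {k : Type w} [Field k] {V : Type u} [Groupoid.{v} V]
    (E : GroupoidRep k V) : Module k E.Summand :=
  inferInstanceAs (Module k (E.DSec ⊗[k] E.Sec))

namespace GroupoidRep.Summand

variable {k : Type w} [Field k] {V : Type u} [Groupoid.{v} V]

/-- The bilinear map `(φ, p) ↦ φ ⊗ p`. -/
noncomputable def tmul (E : GroupoidRep k V) : E.DSec →ₗ[k] E.Sec →ₗ[k] E.Summand :=
  TensorProduct.mk k E.DSec E.Sec

/-- Linear maps out of `Γ(E*) ⊗ Γ(E)`. -/
noncomputable def lift {M : Type*} [AddCommGroup M] [Module k M] {E : GroupoidRep k V}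
    (f : E.DSec →ₗ[k] E.Sec →ₗ[k] M) : E.Summand →ₗ[k] M :=
  TensorProduct.lift f

theorem lift_tmul {M : Type*} [AddCommGroup M] [Module k M] {E : GroupoidRep k V}
    (f : E.DSec →ₗ[k] E.Sec →ₗ[k] M) (φ : E.DSec) (p : E.Sec) : lift f (tmul E φ p) = f φ p :=
  TensorProduct.lift.tmul _ _

theorem induction {E : GroupoidRep k V} {P : E.Summand → Prop} (z : E.Summand) (h0 : P 0)
    (hm : ∀ φ p, P (tmul E φ p)) (ha : ∀ z z', P z → P z' → P (z + z')) : P z :=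
  TensorProduct.induction_on (M := E.DSec) (N := E.Sec) (motive := P) z h0 hm ha

end GroupoidRep.Summand

/-- The relations `φ ⊗ λp - φλ ⊗ p`, for all morphisms `λ : E → F` (including the endomorphisms,
which turns the tensor products over `k` into tensor products over the endomorphism rings). They
identify the summands of isomorphic representations, and their span is an ideal. -/
noncomputable def repFunRelations (k : Type w) [Field k] (V : Type u) [Groupoid.{v} V] :
    Submodule k (DirectSum (GroupoidRep k V) fun E => E.Summand) :=
  letI := Classical.decEq (GroupoidRep k V)
  Submodule.span k {z | ∃ (E F : GroupoidRep k V) (h : GroupoidRep.Hom E F) (φ : F.DSec)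
    (p : E.Sec), z =
      DirectSum.lof k _ (fun E : GroupoidRep k V => E.Summand) F (.tmul F φ (h.onSec p)) -
      DirectSum.lof k _ (fun E : GroupoidRep k V => E.Summand) E (.tmul E (h.onDSec φ) p)}

/-- The algebra `R_k(𝒢)` of representative functions on a groupoid. -/
def RepFun (k : Type w) [Field k] (V : Type u) [Groupoid.{v} V] : Type (max u v (w + 1)) :=
  (DirectSum (GroupoidRep k V) fun E => E.Summand) ⧸ repFunRelations k V

namespace RepFun

open GroupoidRep

variable {k : Type w} [Field k] {V : Type u} [Groupoid.{v} V]

noncomputable instance : AddCommGroup (RepFun k V) :=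
  inferInstanceAs (AddCommGroup (_ ⧸ repFunRelations k V))

noncomputable instance : Module k (RepFun k V) :=
  inferInstanceAs (Module k (_ ⧸ repFunRelations k V))

/-- The bilinear map `(φ, p) ↦` class of `φ ⊗ p`. -/
noncomputable def mkₗ (E : GroupoidRep k V) : E.DSec →ₗ[k] E.Sec →ₗ[k] RepFun k V :=
  letI := Classical.decEq (GroupoidRep k V)
  (Summand.tmul E).compr₂ ((repFunRelations k V).mkQ ∘ₗ
    DirectSum.lof k _ (fun E : GroupoidRep k V => E.Summand) E)

/-- The class of `φ ⊗ p` in `R_k(𝒢)`. -/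
noncomputable def mk (E : GroupoidRep k V) (φ : E.DSec) (p : E.Sec) : RepFun k V := mkₗ E φ p

theorem mk_rel {E F : GroupoidRep k V} (h : Hom E F) (φ : F.DSec) (p : E.Sec) :
    mk F φ (h.onSec p) = mk E (h.onDSec φ) p := by
  refine (Submodule.Quotient.eq (repFunRelations k V)).2 ?_
  exact Submodule.subset_span ⟨E, F, h, φ, p, rfl⟩

/-- A form of the defining relations that is convenient for rewriting. -/
theorem mk_eq {E F : GroupoidRep k V} (h : Hom E F) {φ : F.DSec} {p : E.Sec} {φ' : E.DSec}
    {p' : F.Sec} (hp : ∀ x, h.app x (p x) = p' x) (hφ : ∀ x v, φ x (h.app x v) = φ' x v) :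
    mk E φ' p = mk F φ p' := by
  obtain rfl : h.onSec p = p' := funext hp
  obtain rfl : h.onDSec φ = φ' := funext fun x => LinearMap.ext (hφ x)
  exact (mk_rel h φ p).symm

theorem induction {P : RepFun k V → Prop} (z : RepFun k V) (h0 : P 0)
    (hm : ∀ E φ p, P (mk E φ p)) (ha : ∀ z z', P z → P z' → P (z + z')) : P z := by
  let _ := Classical.decEq (GroupoidRep k V)
  obtain ⟨z, rfl⟩ := Submodule.mkQ_surjective (repFunRelations k V) z
  induction z using DirectSum.induction_on with
  | zero => rw [map_zero]; exact h0
  | of E t =>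
    refine Summand.induction (P := fun t => P ((repFunRelations k V).mkQ
      (DirectSum.of (fun E : GroupoidRep k V => E.Summand) E t))) t ?_ (fun φ p => hm E φ p)
      (fun x y hx hy => ?_)
    · rw [map_zero, map_zero]; exact h0
    · rw [map_add, map_add]; exact ha _ _ hx hy
  | add x y hx hy => rw [map_add]; exact ha _ _ hx hy

theorem relations_le {M : Type*} [AddCommGroup M] [Module k M]
    [DecidableEq (GroupoidRep k V)]
    (f : ∀ E : GroupoidRep k V, E.DSec →ₗ[k] E.Sec →ₗ[k] M)
    (hf : ∀ (E F : GroupoidRep k V) (h : Hom E F) (φ : F.DSec) (p : E.Sec),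
      f F φ (h.onSec p) = f E (h.onDSec φ) p) :
    repFunRelations k V ≤
      LinearMap.ker (DirectSum.toModule k (GroupoidRep k V) M fun E => Summand.lift (f E)) := by
  obtain rfl : ‹DecidableEq (GroupoidRep k V)› = Classical.decEq (GroupoidRep k V) :=
    Subsingleton.elim _ _
  refine Submodule.span_le.2 ?_
  rintro _ ⟨E, F, h, φ, p, rfl⟩
  rw [SetLike.mem_coe, LinearMap.mem_ker, map_sub, DirectSum.toModule_lof,
    DirectSum.toModule_lof, Summand.lift_tmul, Summand.lift_tmul, hf, sub_self]

/-- Linear maps out of `R_k(𝒢)`. -/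
noncomputable def lift {M : Type*} [AddCommGroup M] [Module k M]
    (f : ∀ E : GroupoidRep k V, E.DSec →ₗ[k] E.Sec →ₗ[k] M)
    (hf : ∀ (E F : GroupoidRep k V) (h : Hom E F) (φ : F.DSec) (p : E.Sec),
      f F φ (h.onSec p) = f E (h.onDSec φ) p) : RepFun k V →ₗ[k] M :=
  letI := Classical.decEq (GroupoidRep k V)
  (repFunRelations k V).liftQ _ (relations_le f hf)

theorem lift_mk {M : Type*} [AddCommGroup M] [Module k M]
    (f : ∀ E : GroupoidRep k V, E.DSec →ₗ[k] E.Sec →ₗ[k] M)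
    (hf : ∀ (E F : GroupoidRep k V) (h : Hom E F) (φ : F.DSec) (p : E.Sec),
      f F φ (h.onSec p) = f E (h.onDSec φ) p) (E : GroupoidRep k V) (φ : E.DSec) (p : E.Sec) :
    lift f hf (mk E φ p) = f E φ p := by
  let _ := Classical.decEq (GroupoidRep k V)
  refine (Submodule.liftQ_apply (repFunRelations k V) _
    (DirectSum.lof k _ (fun E : GroupoidRep k V => E.Summand) E (.tmul E φ p))).trans ?_
  rw [DirectSum.toModule_lof, Summand.lift_tmul]

theorem hom_ext {M : Type*} [AddCommGroup M] [Module k M] {f g : RepFun k V →ₗ[k] M}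
    (h : ∀ E φ p, f (mk E φ p) = g (mk E φ p)) : f = g :=
  LinearMap.ext fun z => induction (P := fun z => f z = g z) z (by rw [map_zero, map_zero]) h
    fun z z' hz hz' => by rw [map_add, map_add, hz, hz']

theorem mk_add_left (E : GroupoidRep k V) (φ φ' : E.DSec) (p : E.Sec) :
    mk E (φ + φ') p = mk E φ p + mk E φ' p := LinearMap.map_add₂ (mkₗ E) _ _ _
theorem mk_add_right (E : GroupoidRep k V) (φ : E.DSec) (p p' : E.Sec) :
    mk E φ (p + p') = mk E φ p + mk E φ p' := map_add _ _ _
theorem mk_smul_left (E : GroupoidRep k V) (r : k) (φ : E.DSec) (p : E.Sec) :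
    mk E (r • φ) p = r • mk E φ p := LinearMap.map_smul₂ (mkₗ E) _ _ _
theorem mk_smul_right (E : GroupoidRep k V) (r : k) (φ : E.DSec) (p : E.Sec) :
    mk E φ (r • p) = r • mk E φ p := map_smul _ _ _
theorem mk_sum_left (E : GroupoidRep k V) {ι : Type*} (s : Finset ι) (φ : ι → E.DSec)
    (p : E.Sec) : mk E (∑ i ∈ s, φ i) p = ∑ i ∈ s, mk E (φ i) p :=
  LinearMap.map_sum₂ (mkₗ E) _ _ _
theorem mk_sum_right (E : GroupoidRep k V) {ι : Type*} (s : Finset ι) (φ : E.DSec)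
    (p : ι → E.Sec) : mk E φ (∑ i ∈ s, p i) = ∑ i ∈ s, mk E φ (p i) :=
  map_sum _ _ _

theorem mk_lTensor (E : GroupoidRep k V) {F G : GroupoidRep k V} (h : Hom F G) (φ : E.DSec)
    (p : E.Sec) (ψ : G.DSec) (q : F.Sec) :
    mk (E.tensor G) (tmulDSec E G φ ψ) (tmulSec E G p (h.onSec q)) =
      mk (E.tensor F) (tmulDSec E F φ (h.onDSec ψ)) (tmulSec E F p q) := by
  have h1 : (h.lTensor E).onDSec (tmulDSec E G φ ψ) = tmulDSec E F φ (h.onDSec ψ) :=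
    funext fun x => LinearMap.ext fun v => tmulDSec_eq E F φ (h.onDSec ψ) x
      ((tmulDSec E G φ ψ x) ∘ₗ (LinearMap.lTensor (E.E x) (h.app x)))
      (fun p q => tmulDSec_apply E G φ ψ x p (h.app x q)) v
  rw [← h1]
  exact mk_rel (h.lTensor E) (tmulDSec E G φ ψ) (tmulSec E F p q)

theorem mk_rTensor {E F : GroupoidRep k V} (G : GroupoidRep k V) (h : Hom E F) (φ : F.DSec)
    (p : E.Sec) (ψ : G.DSec) (q : G.Sec) :
    mk (F.tensor G) (tmulDSec F G φ ψ) (tmulSec F G (h.onSec p) q) =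
      mk (E.tensor G) (tmulDSec E G (h.onDSec φ) ψ) (tmulSec E G p q) := by
  have h1 : (h.rTensor G).onDSec (tmulDSec F G φ ψ) = tmulDSec E G (h.onDSec φ) ψ :=
    funext fun x => LinearMap.ext fun v => tmulDSec_eq E G (h.onDSec φ) ψ x
      ((tmulDSec F G φ ψ x) ∘ₗ (LinearMap.rTensor (G.E x) (h.app x)))
      (fun p q => tmulDSec_apply F G φ ψ x (h.app x p) q) v
  rw [← h1]
  exact mk_rel (h.rTensor G) (tmulDSec F G φ ψ) (tmulSec E G p q)

/-- Multiplication by the class of `φ ⊗ p`. -/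
noncomputable def mulAux (E : GroupoidRep k V) (φ : E.DSec) (p : E.Sec) :
    RepFun k V →ₗ[k] RepFun k V :=
  lift (fun F => (mkₗ (E.tensor F)).compl₁₂ (tmulDSec E F φ) (tmulSec E F p))
    (fun _ _ h ψ q => mk_lTensor E h φ p ψ q)

theorem mulAux_mk (E F : GroupoidRep k V) (φ : E.DSec) (p : E.Sec) (ψ : F.DSec) (q : F.Sec) :
    mulAux E φ p (mk F ψ q) = mk (E.tensor F) (tmulDSec E F φ ψ) (tmulSec E F p q) :=
  lift_mk _ _ _ _ _

/-- The multiplication of `R_k(𝒢)`: `(φ ⊗ p)(ψ ⊗ q) = (φ ⊗ ψ) ⊗ (p ⊗ q)`. -/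
noncomputable def mulₗ : RepFun k V →ₗ[k] RepFun k V →ₗ[k] RepFun k V :=
  lift (fun E => LinearMap.mk₂ k (mulAux E)
      (fun φ φ' p => hom_ext fun F ψ q => by
        rw [LinearMap.add_apply, mulAux_mk, mulAux_mk, mulAux_mk, LinearMap.map_add₂, mk_add_left])
      (fun r φ p => hom_ext fun F ψ q => by
        rw [LinearMap.smul_apply, mulAux_mk, mulAux_mk, LinearMap.map_smul₂, mk_smul_left])
      (fun φ p p' => hom_ext fun F ψ q => by
        rw [LinearMap.add_apply, mulAux_mk, mulAux_mk, mulAux_mk, LinearMap.map_add₂, mk_add_right])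
      (fun r φ p => hom_ext fun F ψ q => by
        rw [LinearMap.smul_apply, mulAux_mk, mulAux_mk, LinearMap.map_smul₂, mk_smul_right]))
    (fun E F h φ p => hom_ext fun G ψ q => by
      change mulAux F φ (h.onSec p) _ = mulAux E (h.onDSec φ) p _
      rw [mulAux_mk, mulAux_mk]
      exact mk_rTensor G h φ p ψ q)

noncomputable instance : Mul (RepFun k V) := ⟨fun z z' => mulₗ z z'⟩

theorem mk_mul_mk (E F : GroupoidRep k V) (φ : E.DSec) (p : E.Sec) (ψ : F.DSec) (q : F.Sec) :
    mk E φ p * mk F ψ q = mk (E.tensor F) (tmulDSec E F φ ψ) (tmulSec E F p q) := by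
  change mulₗ (mk E φ p) (mk F ψ q) = _
  refine (LinearMap.congr_fun (lift_mk _ _ E φ p) _).trans ?_
  exact mulAux_mk E F φ p ψ q

/-- The source map `a ↦ 1 ⊗ a`. -/
noncomputable def src (a : V → k) : RepFun k V := mk (triv k V) (fun _ => LinearMap.id) a

/-- The target map `a ↦ a ⊗ 1`. -/
noncomputable def tar (a : V → k) : RepFun k V :=
  mk (triv k V) (fun x => a x • LinearMap.id) (fun _ => (1 : k))

noncomputable instance : One (RepFun k V) :=
  ⟨mk (triv k V) (fun _ => LinearMap.id) (fun _ => (1 : k))⟩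

theorem one_def : (1 : RepFun k V) = mk (triv k V) (fun _ => LinearMap.id) (fun _ => (1 : k)) := rfl

theorem tar_mul (a : V → k) (E : GroupoidRep k V) (φ : E.DSec) (p : E.Sec) :
    tar a * mk E φ p = mk E (fun x => a x • φ x) p := by
  rw [tar, mk_mul_mk]
  refine mk_eq (lidHom E) (fun x => one_smul k _) fun x v => ?_
  refine LinearMap.congr_fun (f := (a x • φ x) ∘ₗ (TensorProduct.lid k (E.E x)).toLinearMap)
    (g := tmulDSec (triv k V) E (fun x => a x • LinearMap.id) φ x)
    (TensorProduct.ext' fun (c : k) p => ?_) v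
  refine Eq.trans ?_ (tmulDSec_apply _ _ _ _ _ _ _).symm
  simp [mul_left_comm, mul_assoc]

theorem src_mul (a : V → k) (E : GroupoidRep k V) (φ : E.DSec) (p : E.Sec) :
    src a * mk E φ p = mk E φ (fun x => a x • p x) := by
  rw [src, mk_mul_mk]
  refine mk_eq (lidHom E) (fun x => rfl) fun x v => ?_
  refine LinearMap.congr_fun (f := φ x ∘ₗ (TensorProduct.lid k (E.E x)).toLinearMap)
    (g := tmulDSec (triv k V) E (fun x => LinearMap.id) φ x)
    (TensorProduct.ext' fun (c : k) p => ?_) v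
  refine Eq.trans ?_ (tmulDSec_apply _ _ _ _ _ _ _).symm
  simp

theorem one_eq_tar : (1 : RepFun k V) = tar 1 := by
  rw [tar, one_def]
  congr 1
  funext x
  exact (one_smul k _).symm

theorem add_mul' (x y z : RepFun k V) : (x + y) * z = x * z + y * z :=
  LinearMap.map_add₂ mulₗ x y z

theorem mul_add' (x y z : RepFun k V) : x * (y + z) = x * y + x * z := map_add (mulₗ x) y z

theorem zero_mul' (z : RepFun k V) : 0 * z = 0 := LinearMap.map_zero₂ mulₗ z
theorem mul_zero' (z : RepFun k V) : z * 0 = 0 := map_zero (mulₗ z)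

theorem mul_comm' (x y : RepFun k V) : x * y = y * x := by
  refine induction (P := fun x => x * y = y * x) x ?_ (fun E φ p => ?_) (fun z z' h h' => ?_)
  · rw [zero_mul', mul_zero']
  · refine induction (P := fun y => mk E φ p * y = y * mk E φ p) y ?_ (fun F ψ q => ?_)
      (fun z z' h h' => ?_)
    · rw [zero_mul', mul_zero']
    · rw [mk_mul_mk, mk_mul_mk]
      refine mk_eq (swapHom E F) (fun x => rfl) fun x v => ?_
      refine LinearMap.congr_fun (f := tmulDSec F E ψ φ x ∘ₗ
        (TensorProduct.comm k (E.E x) (F.E x)).toLinearMap)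
        (g := tmulDSec E F φ ψ x) (TensorProduct.ext' fun p q => ?_) v
      exact (tmulDSec_apply _ _ _ _ _ _ _).trans
        ((mul_comm _ _).trans (tmulDSec_apply _ _ _ _ _ _ _).symm)
    · rw [add_mul', mul_add', h, h']
  · rw [add_mul', mul_add', h, h']

theorem mul_assoc' (x y z : RepFun k V) : x * y * z = x * (y * z) := by
  refine induction (P := fun x => x * y * z = x * (y * z)) x ?_ (fun E φ p => ?_)
    (fun z z' h h' => ?_)
  · simp only [zero_mul']
  · refine induction (P := fun y => mk E φ p * y * z = mk E φ p * (y * z)) y ?_ (fun F ψ q => ?_)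
      (fun z z' h h' => ?_)
    · simp only [mul_zero', zero_mul']
    · refine induction (P := fun z => mk E φ p * mk F ψ q * z = mk E φ p * (mk F ψ q * z)) z ?_
        (fun G χ r => ?_) (fun z z' h h' => ?_)
      · simp only [mul_zero']
      · rw [mk_mul_mk, mk_mul_mk, mk_mul_mk, mk_mul_mk]
        refine mk_eq (assocHom E F G) (fun x => rfl) fun x v => ?_
        refine LinearMap.congr_fun
          (f := tmulDSec E (F.tensor G) φ (tmulDSec F G ψ χ) x ∘ₗ
            (TensorProduct.assoc k (E.E x) (F.E x) (G.E x)).toLinearMap)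
          (g := tmulDSec (E.tensor F) G (tmulDSec E F φ ψ) χ x)
          (TensorProduct.ext_threefold fun p q r => ?_) v
        refine (tmulDSec_apply E (F.tensor G) _ _ _ p (q ⊗ₜ[k] r)).trans ?_
        refine Eq.trans ?_ (tmulDSec_apply (E.tensor F) G _ _ _ (p ⊗ₜ[k] q) r).symm
        rw [tmulDSec_apply F G, tmulDSec_apply E F, mul_assoc]
      · rw [mul_add', mul_add', mul_add', h, h']
    · rw [add_mul', mul_add', add_mul', mul_add', h, h']
  · rw [add_mul', add_mul', add_mul', h, h']

theorem one_mul' (x : RepFun k V) : 1 * x = x := by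
  rw [one_eq_tar]
  refine induction (P := fun x => tar 1 * x = x) x (mul_zero' _) (fun E φ p => ?_)
    (fun z z' h h' => by rw [mul_add', h, h'])
  rw [tar_mul]
  congr 1
  funext x
  exact one_smul k _

noncomputable instance : CommRing (RepFun k V) :=
  { (inferInstance : AddCommGroup (RepFun k V)),
    (inferInstance : Mul (RepFun k V)), (inferInstance : One (RepFun k V)) with
    left_distrib := mul_add'
    right_distrib := add_mul'
    zero_mul := zero_mul'
    mul_zero := mul_zero'
    mul_assoc := mul_assoc'
    mul_comm := mul_comm'
    one_mul := one_mul'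
    mul_one := fun x => (mul_comm' x 1).trans (one_mul' x) }

noncomputable instance : Algebra k (RepFun k V) :=
  Algebra.ofModule (fun r x y => LinearMap.map_smul₂ mulₗ r x y)
    (fun r x y => map_smul (mulₗ x) r y)

theorem algebraMap_eq (r : k) : algebraMap k (RepFun k V) r = src (algebraMap k (V → k) r) := by
  rw [Algebra.algebraMap_eq_smul_one, one_def, ← mk_smul_right, src]
  congr 1
  funext x
  exact mul_one r

theorem algebraMap_eq' (r : k) : algebraMap k (RepFun k V) r = tar (algebraMap k (V → k) r) := by
  rw [Algebra.algebraMap_eq_smul_one, one_def, ← mk_smul_left, tar]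
  rfl

/-- Algebra maps out of `R_k(𝒢)`. -/
noncomputable def algHom {B : Type*} [CommRing B] [Algebra k B] (f : RepFun k V →ₗ[k] B)
    (h1 : f 1 = 1) (hm : ∀ E φ p F ψ q, f (mk E φ p * mk F ψ q) = f (mk E φ p) * f (mk F ψ q)) :
    RepFun k V →ₐ[k] B :=
  AlgHom.ofLinearMap f h1 fun x y => by
    refine induction (P := fun x => f (x * y) = f x * f y) x ?_ (fun E φ p => ?_)
      (fun z z' h h' => ?_)
    · rw [zero_mul, map_zero, zero_mul]
    · refine induction (P := fun y => f (mk E φ p * y) = f (mk E φ p) * f y) y ?_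
        (fun F ψ q => hm _ _ _ _ _ _) (fun z z' h h' => ?_)
      · rw [mul_zero, map_zero, mul_zero]
      · rw [mul_add, map_add, map_add, mul_add, h, h']
    · rw [add_mul, map_add, map_add, add_mul, h, h']

/-- The source map `s(a) = 1 ⊗ a`. -/
noncomputable def s : (V → k) →ₐ[k] RepFun k V where
  toFun := src
  map_one' := rfl
  map_mul' a b := by
    rw [show src b = mk (triv k V) _ b from rfl, src_mul]
    rfl
  map_zero' := map_zero (mkₗ (triv k V) _)
  map_add' a b := mk_add_right _ _ _ _
  commutes' r := (algebraMap_eq r).symm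

/-- The target map `t(a) = a ⊗ 1`. -/
noncomputable def t : (V → k) →ₐ[k] RepFun k V where
  toFun := tar
  map_one' := one_eq_tar.symm
  map_mul' a b := by
    rw [show tar b = mk (triv k V) _ _ from rfl, tar_mul, tar]
    congr 1
    funext x
    exact mul_smul _ _ _
  map_zero' := by
    refine Eq.trans ?_ (LinearMap.map_zero₂ (mkₗ (triv k V)) (fun _ => (1 : k)))
    refine congrArg (fun φ => mk (triv k V) φ _) ?_
    funext x
    exact zero_smul k _
  map_add' a b := by
    refine Eq.trans ?_ (mk_add_left _ _ _ _)
    refine congrArg (fun φ => mk (triv k V) φ _) ?_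
    funext x
    exact add_smul _ _ _
  commutes' r := (algebraMap_eq' r).symm

theorem s_apply (a : V → k) : s a = mk (triv k V) (fun _ => LinearMap.id) a := rfl
theorem t_apply (a : V → k) :
    t a = mk (triv k V) (fun x => a x • LinearMap.id) (fun _ => (1 : k)) := rfl

/-- The linear map underlying `zeta`. -/
noncomputable def zetaₗ : RepFun k V →ₗ[k] ((Σ x y : V, (x ⟶ y)) → k) :=
  lift (fun E => LinearMap.mk₂ k
      (fun φ p g => φ g.2.1 (E.ρ g.2.2 (p g.1)))
      (fun _ _ _ => rfl) (fun _ _ _ => rfl)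
      (fun φ p p' => funext fun g => by
        simp only [Pi.add_apply, map_add])
      (fun r φ p => funext fun g => by
        simp only [Pi.smul_apply, map_smul]))
    (fun E F h φ p => funext fun g => congrArg (φ g.2.1) (h.comm g.2.2 (p g.1)))

theorem zetaₗ_mk (E : GroupoidRep k V) (φ : E.DSec) (p : E.Sec) :
    zetaₗ (mk E φ p) = fun g => φ g.2.1 (E.ρ g.2.2 (p g.1)) := lift_mk _ _ E φ p

/-- `ζ(φ ⊗ p)(g) = φ(t(g))(ρ_g(p(s(g))))`, as a function of the arrows `g` of the groupoid. -/
noncomputable def zeta : RepFun k V →ₐ[k] ((Σ x y : V, (x ⟶ y)) → k) :=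
  algHom zetaₗ (zetaₗ_mk _ _ _) fun E φ p F ψ q => by
    rw [mk_mul_mk, zetaₗ_mk, zetaₗ_mk, zetaₗ_mk]
    funext g
    exact tmulDSec_apply _ _ _ _ _ _ _

theorem zeta_mk (E : GroupoidRep k V) (φ : E.DSec) (p : E.Sec) {x y : V} (g : x ⟶ y) :
    zeta (mk E φ p) ⟨x, y, g⟩ = φ y (E.ρ g (p x)) :=
  congrFun (zetaₗ_mk E φ p) _

/-- The linear map underlying `counit`. -/
noncomputable def counitₗ : RepFun k V →ₗ[k] (V → k) :=
  lift (fun E => LinearMap.mk₂ k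
      (fun φ p x => φ x (p x))
      (fun _ _ _ => rfl) (fun _ _ _ => rfl)
      (fun φ p p' => funext fun g => by
        simp only [Pi.add_apply, map_add])
      (fun r φ p => funext fun g => by
        simp only [Pi.smul_apply, map_smul]))
    (fun E F h φ p => rfl)

theorem counitₗ_mk (E : GroupoidRep k V) (φ : E.DSec) (p : E.Sec) :
    counitₗ (mk E φ p) = fun x => φ x (p x) := lift_mk _ _ E φ p

/-- The counit `ε(φ ⊗ p)(x) = φ(x)(p(x))`. -/
noncomputable def counit : RepFun k V →ₐ[k] (V → k) :=
  algHom counitₗ (counitₗ_mk _ _ _) fun E φ p F ψ q => by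
    rw [mk_mul_mk, counitₗ_mk, counitₗ_mk, counitₗ_mk]
    funext g
    exact tmulDSec_apply _ _ _ _ _ _ _

theorem counit_mk (E : GroupoidRep k V) (φ : E.DSec) (p : E.Sec) :
    counit (mk E φ p) = fun x => φ x (p x) := counitₗ_mk E φ p

/-- The section `p̃` of `E**` given by evaluation at the section `p` of `E`. -/
def evSec (E : GroupoidRep k V) : E.Sec →ₗ[k] E.dual.DSec where
  toFun p x := Module.Dual.eval k (E.E x) (p x)
  map_add' _ _ := funext fun _ => map_add _ _ _
  map_smul' _ _ := funext fun _ => map_smul _ _ _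

/-- The linear map underlying `antipode`. -/
noncomputable def antipodeₗ : RepFun k V →ₗ[k] RepFun k V :=
  lift (fun E => (mkₗ E.dual).flip.compl₁₂ LinearMap.id (evSec E))
    (fun _ _ h _ _ => mk_eq h.transpose (fun _ => rfl) fun _ _ => rfl)

theorem antipodeₗ_mk (E : GroupoidRep k V) (φ : E.DSec) (p : E.Sec) :
    antipodeₗ (mk E φ p) = mk E.dual (evSec E p) φ := lift_mk _ _ E φ p

/-- The antipode `S(φ ⊗ p) = p̃ ⊗ φ`, with `p̃` the evaluation at `p`. -/
noncomputable def antipode : RepFun k V →ₐ[k] RepFun k V :=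
  algHom antipodeₗ
    (by
      rw [one_def, antipodeₗ_mk]
      exact (mk_eq (trivDualHom k V) (fun x => one_smul k _)
        fun x (v : k) => (mul_one v)).symm)
    (fun E φ p F ψ q => by
      rw [mk_mul_mk, antipodeₗ_mk, antipodeₗ_mk, antipodeₗ_mk, mk_mul_mk]
      refine (mk_eq (dualTensorHom E F) (fun x => rfl) fun x v => ?_).symm
      exact tmulDSec_eq E.dual F.dual (evSec E p) (evSec F q) x
        ((Module.Dual.eval k (E.E x ⊗[k] F.E x) (p x ⊗ₜ[k] q x)) ∘ₗ
          TensorProduct.dualDistrib k (E.E x) (F.E x))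
        (fun φ ψ => TensorProduct.dualDistrib_apply φ ψ (p x) (q x)) v)

theorem antipode_mk (E : GroupoidRep k V) (φ : E.DSec) (p : E.Sec) :
    antipode (mk E φ p) = mk E.dual (evSec E p) φ := antipodeₗ_mk E φ p

theorem mk_mul_s (E : GroupoidRep k V) (φ : E.DSec) (p : E.Sec) (a : V → k) :
    mk E φ p * s a = mk E φ (fun x => a x • p x) := (mul_comm _ _).trans (src_mul a E φ p)

theorem t_mul_mk (E : GroupoidRep k V) (φ : E.DSec) (p : E.Sec) (a : V → k) :
    t a * mk E φ p = mk E (fun x => a x • φ x) p := tar_mul a E φ p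

end RepFun

namespace RepFun

open GroupoidRep TensorOver

variable {k : Type w} [Field k] {V : Type u} [Groupoid.{v} V]

/-- `R_k(𝒢) ⊗_A R_k(𝒢)`. -/
abbrev RepFun2 (k : Type w) [Field k] (V : Type u) [Groupoid.{v} V] :=
  TensorOver (s (k := k) (V := V)) (t (k := k) (V := V))

/-- The pure tensor `z ⊗_A y`. -/
noncomputable abbrev tm (z y : RepFun k V) : RepFun2 k V :=
  tmul (s (k := k) (V := V)) (t (k := k) (V := V)) z y

/-- `∑ᵢ (φ ⊗ eᵢ) ⊗_A (eᵢ* ⊗ p)`. -/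
noncomputable def comulAux (E : GroupoidRep k V) (φ : E.DSec) (p : E.Sec) : RepFun2 k V :=
  ∑ i, tm (mk E φ (E.b i)) (mk E (E.c i) p)

theorem tmul_sum {ι : Type*} (I : Finset ι) (z : RepFun k V) (y : ι → RepFun k V) :
    tm z (∑ i ∈ I, y i) = ∑ i ∈ I, tm z (y i) :=
  map_sum (AddMonoidHom.mk' (fun y : RepFun k V => tm z y) (fun a b => tmul_add z a b)) y I

theorem sum_tmul {ι : Type*} (I : Finset ι) (z : ι → RepFun k V) (y : RepFun k V) :
    tm (∑ i ∈ I, z i) y = ∑ i ∈ I, tm (z i) y :=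
  map_sum (AddMonoidHom.mk' (fun z : RepFun k V => tm z y) (fun a b => add_tmul a b y)) z I

theorem tmul_mk_balanced (E F : GroupoidRep k V) (φ : E.DSec) (p : E.Sec) (ψ : F.DSec)
    (q : F.Sec) (a : V → k) :
    tm (mk E φ (fun x => a x • p x)) (mk F ψ q) =
      tm (mk E φ p) (mk F (fun x => a x • ψ x) q) := by
  rw [← mk_mul_s, ← t_mul_mk]
  exact tmul_balanced (f := s (k := k) (V := V)) (g := t) _ _ _

/-- `∑ⱼ (φ ⊗ fⱼ) ⊗ (fⱼ* T ⊗ p) = ∑ᵢ (φ ⊗ T eᵢ) ⊗ (eᵢ* ⊗ p)` for every family `T` of linear maps. -/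
theorem casimir (E F : GroupoidRep k V) (T : ∀ x, E.E x →ₗ[k] F.E x) (φ : F.DSec) (p : E.Sec) :
    ∑ j, tm (mk F φ (F.b j)) (mk E (fun x => F.c j x ∘ₗ T x) p) =
      ∑ i, tm (mk F φ (fun x => T x (E.b i x))) (mk E (E.c i) p) := by
  have h1 : ∀ j, (fun x => F.c j x ∘ₗ T x : E.DSec) =
      ∑ i, (fun x => (F.c j x (T x (E.b i x))) • E.c i x : E.DSec) := fun j => by
    funext x
    rw [Finset.sum_apply]
    exact (E.sum_smul_c x (F.c j x ∘ₗ T x)).symm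
  have h2 : ∀ i, (fun x => T x (E.b i x) : F.Sec) =
      ∑ j, (fun x => (F.c j x (T x (E.b i x))) • F.b j x : F.Sec) := fun i => by
    funext x
    rw [Finset.sum_apply]
    exact (F.sum_c_smul_b x _).symm
  calc _ = ∑ j, ∑ i, tm (mk F φ (F.b j))
        (mk E (fun x => (F.c j x (T x (E.b i x))) • E.c i x) p) := by
        refine Finset.sum_congr rfl fun j _ => ?_
        rw [h1 j, mk_sum_left, tmul_sum]
    _ = ∑ i, ∑ j, tm (mk F φ (F.b j))
        (mk E (fun x => (F.c j x (T x (E.b i x))) • E.c i x) p) := Finset.sum_comm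
    _ = _ := by
        refine Finset.sum_congr rfl fun i _ => ?_
        rw [h2 i, mk_sum_right, sum_tmul]
        exact Finset.sum_congr rfl fun j _ => (tmul_mk_balanced _ _ _ _ _ _ _).symm

theorem comulAux_rel (E F : GroupoidRep k V) (h : Hom E F) (φ : F.DSec) (p : E.Sec) :
    comulAux F φ (h.onSec p) = comulAux E (h.onDSec φ) p := by
  calc comulAux F φ (h.onSec p)
      = ∑ j, tm (mk F φ (F.b j)) (mk E (fun x => F.c j x ∘ₗ h.app x) p) :=
        Finset.sum_congr rfl fun j _ => by rw [mk_rel]; rfl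
    _ = ∑ i, tm (mk F φ (fun x => h.app x (E.b i x))) (mk E (E.c i) p) := casimir E F h.app φ p
    _ = comulAux E (h.onDSec φ) p := Finset.sum_congr rfl fun i _ => by rw [← mk_rel]; rfl

/-- The linear map underlying `comul`. -/
noncomputable def comulₗ : RepFun k V →ₗ[k] RepFun2 k V :=
  lift (fun E => LinearMap.mk₂ k (comulAux E)
      (fun φ φ' p => by
        simp only [comulAux, mk_add_left, add_tmul, Finset.sum_add_distrib])
      (fun r φ p => by
        simp only [comulAux, mk_smul_left, smul_tmul_left, Finset.smul_sum])
      (fun φ p p' => by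
        simp only [comulAux, mk_add_right, tmul_add, Finset.sum_add_distrib])
      (fun r φ p => by
        simp only [comulAux, mk_smul_right, tmul_smul_right, Finset.smul_sum]))
    comulAux_rel

theorem comulₗ_mk (E : GroupoidRep k V) (φ : E.DSec) (p : E.Sec) :
    comulₗ (mk E φ p) = ∑ i, tm (mk E φ (E.b i)) (mk E (E.c i) p) := lift_mk _ _ E φ p

/-- The comultiplication of `φ ⊗ p`, in the trivial representation, is `(φ ⊗ 1) ⊗ (1 ⊗ p)`. -/
theorem comulₗ_mk_triv (φ : (triv k V).DSec) (p : (triv k V).Sec) :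
    comulₗ (mk (triv k V) φ p) = tm (mk (triv k V) φ (fun _ => (1 : k)))
      (mk (triv k V) (fun _ => LinearMap.id) p) := by
  rw [comulₗ_mk]
  have hb : (triv k V).b (0 : Fin 1) = fun _ => (1 : k) := by
    funext x
    change Module.Basis.ofEquivFun (LinearEquiv.funUnique (Fin 1) k k).symm (0 : Fin 1) = 1
    rw [Module.Basis.coe_ofEquivFun]
    exact Pi.single_eq_same (M := fun _ : Fin 1 => k) 0 1
  have hc : (triv k V).c (0 : Fin 1) = fun _ => LinearMap.id := by
    funext x
    refine LinearMap.ext fun (v : k) => ?_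
    change (Module.Basis.ofEquivFun (LinearEquiv.funUnique (Fin 1) k k).symm).coord (0 : Fin 1) v
      = v
    rw [Module.Basis.coord_apply, Module.Basis.ofEquivFun_repr_apply]
    rfl
  refine (Fin.sum_univ_one (fun i : Fin 1 => tm (mk (triv k V) φ ((triv k V).b i))
    (mk (triv k V) ((triv k V).c i) p))).trans ?_
  rw [hb, hc]

/-- The comultiplication `Δ(φ ⊗ p) = ∑ᵢ (φ ⊗ eᵢ) ⊗_A (eᵢ* ⊗ p)`. -/
noncomputable def comul : RepFun k V →ₐ[k] RepFun2 k V :=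
  algHom comulₗ (by rw [one_def, comulₗ_mk_triv]; rfl) fun E φ p F ψ q => by
    rw [mk_mul_mk, comulₗ_mk, comulₗ_mk, comulₗ_mk, Finset.sum_mul_sum]
    refine (Equiv.sum_comp finProdFinEquiv _).symm.trans ((Fintype.sum_prod_type _).trans ?_)
    refine Finset.sum_congr rfl fun i _ => Finset.sum_congr rfl fun j _ => ?_
    rw [tmul_mul_tmul, mk_mul_mk, mk_mul_mk, tensor_b, tensor_c]

theorem comul_mk (E : GroupoidRep k V) (φ : E.DSec) (p : E.Sec) :
    comul (mk E φ p) = ∑ i, tm (mk E φ (E.b i)) (mk E (E.c i) p) := comulₗ_mk E φ p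

theorem sum_mk_ev (E : GroupoidRep k V) (φ : E.DSec) (p : E.Sec) :
    ∑ i, mk E.dual (evSec E (E.b i)) φ * mk E (E.c i) p = s (fun x => φ x (p x)) := by
  rw [s_apply]
  have h1 : (∑ i, tmulDSec E.dual E (evSec E (E.b i)) (E.c i)) =
      (evHom E).onDSec (fun _ => LinearMap.id) := by
    refine tensor_dsec_ext fun x (φ : Module.Dual k (E.E x)) p => ?_
    rw [Finset.sum_apply, LinearMap.sum_apply]
    refine (Finset.sum_congr rfl fun i _ =>
      tmulDSec_apply E.dual E (evSec E (E.b i)) (E.c i) x φ p).trans ?_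
    change ∑ i, φ (E.b i x) * E.c i x p = φ p
    conv_rhs => rw [← E.sum_smul_c x φ]
    simp
  simp only [mk_mul_mk]
  rw [← mk_sum_left, h1, ← mk_rel]
  rfl

theorem sum_mk_coev (E : GroupoidRep k V) (φ : E.DSec) (p : E.Sec) :
    ∑ i, mk E φ (E.b i) * mk E.dual (evSec E p) (E.c i) = t (fun x => φ x (p x)) := by
  rw [t_apply]
  have h1 : (∑ i, tmulSec E E.dual (E.b i) (E.c i)) =
      (coevHom E).onSec (fun _ => (1 : k)) := by
    funext x
    rw [Finset.sum_apply]
    exact (one_smul k _).symm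
  have h2 : (coevHom E).onDSec (tmulDSec E E.dual φ (evSec E p)) =
      fun x => φ x (p x) • LinearMap.id := by
    funext x
    refine LinearMap.ext fun (r : k) => ?_
    change tmulDSec E E.dual φ (evSec E p) x (r • ∑ i, E.b i x ⊗ₜ[k] E.c i x) = φ x (p x) • r
    rw [map_smul, map_sum]
    have h3 : ∀ i, tmulDSec E E.dual φ (evSec E p) x (E.b i x ⊗ₜ[k] E.c i x) =
        φ x (E.b i x) * E.c i x (p x) := fun i =>
      tmulDSec_apply E E.dual φ (evSec E p) x (E.b i x) (E.c i x)
    have h4 : ∑ i, φ x (E.b i x) * E.c i x (p x) = φ x (p x) := by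
      conv_rhs => rw [← E.sum_smul_c x (φ x)]
      simp
    rw [Finset.sum_congr rfl fun i _ => h3 i, h4, smul_eq_mul, smul_eq_mul, mul_comm]
  simp only [mk_mul_mk]
  rw [← mk_sum_right, h1, mk_rel, h2]

/-- The source, target, comultiplication, counit and antipode of `R_k(𝒢)`. -/
noncomputable abbrev hopfData (k : Type w) [Field k] (V : Type u) [Groupoid.{v} V] :
    CommHopfAlgebroidData k (V → k) (RepFun k V) where
  s := s
  t := t
  Δ := comul
  ε := counit
  S := antipode
  Δ_s a := comulₗ_mk_triv _ _
  Δ_t a := comulₗ_mk_triv _ _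
  ε_s a := counit_mk _ _ _
  ε_t a := (counit_mk _ _ _).trans (funext fun x => mul_one _)
  S_s a := by
    rw [s_apply, antipode_mk]
    exact (mk_eq (trivDualHom k V) (fun x => one_smul k _)
        fun x (v : k) => mul_comm v (a x)).symm
  S_t a := by
    rw [t_apply, antipode_mk]
    exact (mk_eq (trivDualHom k V) (fun x => rfl)
        fun x (v : k) => (mul_one v)).symm

/-- The commutative Hopf algebroid `R_k(𝒢)` over `A = Fun(𝒢⁰, k)`. -/
noncomputable def hopfAlgebroid (k : Type w) [Field k] (V : Type u) [Groupoid.{v} V] :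
    CommHopfAlgebroid k (V → k) (RepFun k V) where
  toCommHopfAlgebroidData := hopfData k V
  coassoc h := by
    refine induction (P := fun h => (hopfData k V).ΔId (comul h) = (hopfData k V).idΔ (comul h))
      h ?_ (fun E φ p => ?_) (fun z z' h h' => ?_)
    · rw [map_zero, map_zero, map_zero]
    · rw [comul_mk, map_sum, map_sum]
      refine (Finset.sum_congr rfl fun i _ => (hopfData k V).ΔId_sum Finset.univ _ _ _
        (comul_mk E φ (E.b i)) (mk E (E.c i) p)).trans ?_
      refine Finset.sum_comm.trans (Finset.sum_congr rfl fun i _ => ?_)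
      exact ((hopfData k V).idΔ_sum Finset.univ _ _ _ (comul_mk E (E.c i) p) (mk E φ (E.b i))).symm
    · rw [map_add, map_add, map_add, h, h']
  counit_left h := by
    refine induction (P := fun h => (hopfData k V).εId (comul h) = h)
      h ?_ (fun E φ p => ?_) (fun z z' h h' => ?_)
    · rw [map_zero, map_zero]
    · rw [comul_mk, map_sum]
      have h1 : ∀ i, (hopfData k V).εId (tm (mk E φ (E.b i)) (mk E (E.c i) p)) =
          mk E (fun x => φ x (E.b i x) • E.c i x) p := fun i =>
        ((hopfData k V).εId_tmul _ _).trans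
          ((congrArg (fun a => t a * _) (counit_mk _ _ _)).trans (t_mul_mk _ _ _ _))
      rw [Finset.sum_congr rfl fun i _ => h1 i, ← mk_sum_left]
      congr 1
      funext x
      rw [Finset.sum_apply]
      exact E.sum_smul_c x (φ x)
    · rw [map_add, map_add, h, h']
  counit_right h := by
    refine induction (P := fun h => (hopfData k V).idε (comul h) = h)
      h ?_ (fun E φ p => ?_) (fun z z' h h' => ?_)
    · rw [map_zero, map_zero]
    · rw [comul_mk, map_sum]
      have h1 : ∀ i, (hopfData k V).idε (tm (mk E φ (E.b i)) (mk E (E.c i) p)) =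
          mk E φ (fun x => E.c i x (p x) • E.b i x) := fun i =>
        ((hopfData k V).idε_tmul _ _).trans
          ((congrArg (fun a => _ * s a) (counit_mk _ _ _)).trans (mk_mul_s _ _ _ _))
      rw [Finset.sum_congr rfl fun i _ => h1 i, ← mk_sum_right]
      congr 1
      funext x
      rw [Finset.sum_apply]
      exact E.sum_c_smul_b x (p x)
    · rw [map_add, map_add, h, h']
  antipode_left h := by
    refine induction (P := fun h => (hopfData k V).SId (comul h) = s (counit h))
      h ?_ (fun E φ p => ?_) (fun z z' h h' => ?_)
    · simp only [map_zero]
    · rw [comul_mk, map_sum, counit_mk, ← sum_mk_ev]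
      exact Finset.sum_congr rfl fun i _ => ((hopfData k V).SId_tmul _ _).trans
        (congrArg (· * _) (antipode_mk _ _ _))
    · simp only [map_add, h, h']
  antipode_right h := by
    refine induction (P := fun h => (hopfData k V).idS (comul h) = t (counit h))
      h ?_ (fun E φ p => ?_) (fun z z' h h' => ?_)
    · simp only [map_zero]
    · rw [comul_mk, map_sum, counit_mk, ← sum_mk_coev]
      exact Finset.sum_congr rfl fun i _ => ((hopfData k V).idS_tmul _ _).trans
        (congrArg (_ * ·) (antipode_mk _ _ _))
    · simp only [map_add, h, h']

end RepFun

namespace RepFun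

open GroupoidRep TensorOver

variable {k : Type w} [Field k] {V : Type u} [Groupoid.{v} V]

theorem zeta_s (a : V → k) (g : Σ x y : V, (x ⟶ y)) : zeta (s a) g = a g.1 :=
  zeta_mk (triv k V) (fun _ => LinearMap.id) a g.2.2

theorem zeta_t (a : V → k) (g : Σ x y : V, (x ⟶ y)) : zeta (t a) g = a g.2.1 :=
  (zeta_mk (triv k V) (fun x => a x • LinearMap.id) (fun _ => (1 : k)) g.2.2).trans (mul_one _)

theorem zeta_id (F : RepFun k V) (x : V) : zeta F ⟨x, x, 𝟙 x⟩ = counit F x := by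
  refine induction (P := fun F => zeta F ⟨x, x, 𝟙 x⟩ = counit F x) F ?_ (fun E φ p => ?_)
    (fun z z' h h' => ?_)
  · rw [map_zero, map_zero]; rfl
  · rw [zeta_mk, counit_mk, ρ_id_apply]
  · rw [map_add, map_add, Pi.add_apply, Pi.add_apply, h, h']

theorem zeta_antipode (F : RepFun k V) {x y : V} (g : x ⟶ y) :
    zeta (antipode F) ⟨x, y, g⟩ = zeta F ⟨y, x, Groupoid.inv g⟩ := by
  refine induction
    (P := fun F => zeta (antipode F) ⟨x, y, g⟩ = zeta F ⟨y, x, Groupoid.inv g⟩) F ?_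
    (fun E φ p => ?_) (fun z z' h h' => ?_)
  · rw [map_zero, map_zero]; rfl
  · rw [antipode_mk, zeta_mk, zeta_mk]
    rfl
  · rw [map_add, map_add, map_add, Pi.add_apply, Pi.add_apply, h, h']

/-- `ζ(φ ⊗ p)(gh) = ∑ᵢ ζ(φ ⊗ eᵢ)(g) ζ(eᵢ* ⊗ p)(h)`. -/
theorem sum_zeta_mul_zeta (E : GroupoidRep k V) (φ : E.DSec) (p : E.Sec) {x y z : V}
    (h : x ⟶ y) (g : y ⟶ z) :
    ∑ i, zeta (mk E φ (E.b i)) ⟨y, z, g⟩ * zeta (mk E (E.c i) p) ⟨x, y, h⟩ =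
      zeta (mk E φ p) ⟨x, z, h ≫ g⟩ := by
  simp only [zeta_mk]
  conv_rhs => rw [ρ_comp_apply, ← E.sum_c_smul_b y (E.ρ h (p x))]
  simp only [map_sum, map_smul, smul_eq_mul]
  exact Finset.sum_congr rfl fun i _ => mul_comm _ _

end RepFun

namespace LocalBisection

open RepFun

variable {k : Type w} [Field k] {V : Type u} [Groupoid.{v} V]

open Classical in
/-- Restriction of a representative function along a local bisection, extended by zero. -/
noncomputable def restrict (k : Type w) [Field k] (b : LocalBisection V) :
    RepFun k V →ₙₐ[k] (V → k) where
  toFun F x := if hx : x ∈ b.dom then zeta F ⟨x, b.u x hx⟩ else 0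
  map_smul' c F := funext fun x => by
    by_cases hx : x ∈ b.dom
    · simp [hx]
    · simp [hx]
  map_zero' := funext fun x => by simp
  map_add' F G := funext fun x => by
    by_cases hx : x ∈ b.dom
    · simp [hx]
    · simp [hx]
  map_mul' F G := funext fun x => by
    by_cases hx : x ∈ b.dom
    · simp [hx]
    · simp [hx]

theorem restrict_of_mem (b : LocalBisection V) (F : RepFun k V) {x : V} (hx : x ∈ b.dom) :
    restrict k b F x = zeta F ⟨x, b.u x hx⟩ := dif_pos hx

theorem restrict_of_notMem (b : LocalBisection V) (F : RepFun k V) {x : V} (hx : x ∉ b.dom) :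
    restrict k b F x = 0 := dif_neg hx

theorem restrict_one_of_mem (b : LocalBisection V) {x : V} (hx : x ∈ b.dom) :
    restrict k b 1 x = 1 := by
  rw [restrict_of_mem b _ hx, map_one]
  rfl

theorem restrict_s (b : LocalBisection V) (a : V → k) :
    restrict k b (s a) = a * restrict k b 1 := by
  funext x
  by_cases hx : x ∈ b.dom
  · rw [Pi.mul_apply, restrict_one_of_mem b hx, mul_one, restrict_of_mem b _ hx, zeta_s]
  · rw [Pi.mul_apply, restrict_of_notMem b _ hx, restrict_of_notMem b _ hx, mul_zero]

theorem restrict_t_of_mem (b : LocalBisection V) (a : V → k) {x : V} (hx : x ∈ b.dom) :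
    restrict k b (t a) x = a (b.tgt x hx) := by
  rw [restrict_of_mem b _ hx, zeta_t]
  rfl

theorem tgt_mem_pinv_dom (b : LocalBisection V) {x : V} (hx : x ∈ b.dom) :
    b.tgt x hx ∈ b.pinv.dom := ⟨x, hx, rfl⟩

theorem mem_span_restrict_one_iff (b : LocalBisection V) (a : V → k) :
    a ∈ Ideal.span {restrict k b 1} ↔ ∀ x, x ∉ b.dom → a x = 0 := by
  rw [Ideal.mem_span_singleton']
  constructor
  · rintro ⟨r, rfl⟩ x hx
    rw [Pi.mul_apply, restrict_of_notMem b _ hx, mul_zero]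
  · refine fun h => ⟨a, funext fun x => ?_⟩
    by_cases hx : x ∈ b.dom
    · rw [Pi.mul_apply, restrict_one_of_mem b hx, mul_one]
    · rw [Pi.mul_apply, restrict_of_notMem b _ hx, mul_zero, h x hx]

theorem restrict_t_bijOn (b : LocalBisection V) :
    Set.BijOn (fun a : V → k => restrict k b (t a)) (Ideal.span {restrict k b.pinv 1})
      (Ideal.span {restrict k b 1}) := by
  refine ⟨fun a _ => ?_, fun a ha a' ha' h => ?_, fun z hz => ?_⟩
  · exact (mem_span_restrict_one_iff b _).2 fun x hx => restrict_of_notMem b _ hx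
  · rw [SetLike.mem_coe, mem_span_restrict_one_iff] at ha ha'
    funext y
    by_cases hy : y ∈ b.pinv.dom
    · obtain ⟨x, hx, rfl⟩ := hy
      rw [← restrict_t_of_mem b a hx, ← restrict_t_of_mem b a' hx]
      exact congrFun h x
    · rw [ha y hy, ha' y hy]
  · rw [SetLike.mem_coe, mem_span_restrict_one_iff] at hz
    refine ⟨restrict k b.pinv (t z), ?_, funext fun x => ?_⟩
    · exact (mem_span_restrict_one_iff b.pinv _).2 fun x hx => restrict_of_notMem b.pinv _ hx
    · by_cases hx : x ∈ b.dom
      · change restrict k b (t _) x = _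
        rw [restrict_t_of_mem b _ hx, restrict_t_of_mem b.pinv z (b.tgt_mem_pinv_dom hx),
          tgt_pinv]
      · exact (restrict_of_notMem b _ hx).trans (hz x hx).symm

/-- The local biretraction of `R_k(𝒢)` defined by a local bisection of `𝒢`. -/
noncomputable def biretraction (k : Type w) [Field k] (b : LocalBisection V) :
    LocalBiretraction (hopfAlgebroid k V) where
  toHom := restrict k b
  map_s := restrict_s b
  exists_idem := ⟨restrict k b.pinv 1, funext fun x => by
    by_cases hx : x ∈ b.dom
    · exact (restrict_t_of_mem b _ hx).trans
        ((restrict_one_of_mem b.pinv (b.tgt_mem_pinv_dom hx)).trans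
          (restrict_one_of_mem b hx).symm)
    · exact (restrict_of_notMem b _ hx).trans (restrict_of_notMem b _ hx).symm,
    restrict_t_bijOn b⟩

theorem biretraction_apply (b : LocalBisection V) (F : RepFun k V) :
    biretraction k b F = restrict k b F := rfl

theorem biretraction_one : biretraction k (1 : LocalBisection V) = 1 :=
  LocalBiretraction.ext' fun F => funext fun x =>
    (restrict_of_mem (1 : LocalBisection V) F (Set.mem_univ x)).trans (zeta_id F x)

theorem biretraction_mul_mk (b c : LocalBisection V) (E : GroupoidRep k V) (φ : E.DSec)
    (p : E.Sec) : (biretraction k b * biretraction k c) (RepFun.mk E φ p) =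
      ∑ i, restrict k c (t (restrict k b (RepFun.mk E φ (E.b i)))) * restrict k c (RepFun.mk E (E.c i) p) := by
  rw [LocalBiretraction.mul_apply]
  refine (congrArg _ (comul_mk E φ p)).trans ((map_sum _ _ _).trans ?_)
  exact Finset.sum_congr rfl fun i _ => LocalBiretraction.pair_tmul _ _ _ _

theorem biretraction_mul (b c : LocalBisection V) :
    biretraction k (b * c) = biretraction k b * biretraction k c := by
  have h : ∀ E φ p, biretraction k (b * c) (RepFun.mk E φ p) =
      (biretraction k b * biretraction k c) (RepFun.mk E φ p) := fun E φ p => by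
    rw [biretraction_mul_mk, biretraction_apply]
    funext x
    rw [Finset.sum_apply]
    simp only [Pi.mul_apply]
    by_cases hx : x ∈ c.dom
    · simp only [restrict_t_of_mem c _ hx, restrict_of_mem c _ hx]
      by_cases hy : c.tgt x hx ∈ b.dom
      · simp only [restrict_of_mem b _ hy]
        exact (restrict_of_mem (b * c) _ ⟨hx, hy⟩).trans
          (sum_zeta_mul_zeta E φ p (c.arr x hx) (b.arr _ hy)).symm
      · simp only [restrict_of_notMem b _ hy, zero_mul, Finset.sum_const_zero]
        exact restrict_of_notMem (b * c) _ fun h => hy h.2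
    · simp only [restrict_of_notMem c _ hx, mul_zero, Finset.sum_const_zero]
      exact restrict_of_notMem (b * c) _ fun h => hx h.1
  exact LocalBiretraction.ext' fun F => LinearMap.congr_fun
    (hom_ext (f := ((biretraction k (b * c)).toHom : RepFun k V →ₗ[k] (V → k)))
      (g := ((biretraction k b * biretraction k c).toHom : RepFun k V →ₗ[k] (V → k))) h) F

theorem biretraction_pinv (b : LocalBisection V) :
    biretraction k b.pinv = (biretraction k b).pinv := by
  refine LocalBiretraction.ext' fun F => ?_
  rw [LocalBiretraction.pinv_apply]
  refine ((biretraction k b).tInv_eq (funext fun y => ?_) (funext fun x => ?_)).symm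
  · rw [Pi.mul_apply]
    by_cases hy : y ∈ b.pinv.dom
    · obtain ⟨x, hx, rfl⟩ := hy
      have h : (biretraction k b).e (b.tgt x hx) = 1 :=
        (restrict_t_of_mem b _ hx).symm.trans
          ((congrFun (biretraction k b).map_e x).trans (restrict_one_of_mem b hx))
      rw [h, mul_one]
    · rw [biretraction_apply, restrict_of_notMem b.pinv _ hy, zero_mul]
  · by_cases hx : x ∈ b.dom
    · refine (restrict_t_of_mem b _ hx).trans ?_
      rw [biretraction_apply, restrict_of_mem b.pinv _ (b.tgt_mem_pinv_dom hx), pinv_u]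
      exact (zeta_antipode F (b.arr x hx)).symm.trans (restrict_of_mem b _ hx).symm
    · exact (restrict_of_notMem b _ hx).trans (restrict_of_notMem b _ hx).symm

/-- The morphism of regular monoids from local bisections to local biretractions. -/
noncomputable def biretractionHom (k : Type w) [Field k] (V : Type u) [Groupoid.{v} V] :
    RegularMonoidHom (LocalBisection V) (LocalBiretraction (hopfAlgebroid k V)) where
  toFun := biretraction k
  map_one' := biretraction_one
  map_mul' := biretraction_mul
  map_pinv := biretraction_pinv

theorem restrict_mk (b : LocalBisection V) (E : GroupoidRep k V) (φ : E.DSec) (p : E.Sec)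
    (x : V) : (∀ hx : x ∈ b.dom,
      restrict k b (RepFun.mk E φ p) x = φ (b.tgt x hx) (E.ρ (b.arr x hx) (p x))) ∧
    (x ∉ b.dom → restrict k b (RepFun.mk E φ p) x = 0) :=
  ⟨fun hx => (restrict_of_mem b _ hx).trans (zeta_mk E φ p (b.arr x hx)),
    restrict_of_notMem b _⟩

end LocalBisection

theorem mainTheorem6 (k : Type w) [Field k] [CharZero k]
    (V : Type u) [CategoryTheory.Groupoid.{v} V] :
    (∀ b : LocalBisection V, ∃! f : RepFun k V →ₗ[k] (V → k),
      ∀ (E : GroupoidRep k V) (φ : E.DSec) (p : E.Sec) (x : V),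
        (∀ hx : x ∈ b.dom, f (RepFun.mk E φ p) x = φ (b.tgt x hx) (E.ρ (b.arr x hx) (p x))) ∧
        (x ∉ b.dom → f (RepFun.mk E φ p) x = 0)) ∧
    ∃ α : RegularMonoidHom (LocalBisection V) (LocalBiretraction (RepFun.hopfAlgebroid k V)),
      (∀ (b : LocalBisection V) (E : GroupoidRep k V) (φ : E.DSec) (p : E.Sec) (x : V),
        (∀ hx : x ∈ b.dom,
          α.toFun b (RepFun.mk E φ p) x = φ (b.tgt x hx) (E.ρ (b.arr x hx) (p x))) ∧
        (x ∉ b.dom → α.toFun b (RepFun.mk E φ p) x = 0)) ∧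
      (∀ (b : LocalBisection V) (F : RepFun k V) (x : V),
        (∀ hx : x ∈ b.dom, α.toFun b F x = RepFun.zeta F ⟨x, b.tgt x hx, b.arr x hx⟩) ∧
        (x ∉ b.dom → α.toFun b F x = 0)) := by
  refine ⟨fun b => ⟨(b.restrict k : RepFun k V →ₗ[k] (V → k)), b.restrict_mk, fun f hf => ?_⟩,
    LocalBisection.biretractionHom k V, fun b => b.restrict_mk,
    fun b F x => ⟨b.restrict_of_mem F, b.restrict_of_notMem F⟩⟩
  refine RepFun.hom_ext fun E φ p => funext fun x => ?_
  by_cases hx : x ∈ b.dom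
  · exact ((hf E φ p x).1 hx).trans ((b.restrict_mk E φ p x).1 hx).symm
  · exact ((hf E φ p x).2 hx).trans (b.restrict_of_notMem _ hx).symm
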